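/- **Setting.** For $d\ge 1$ let $\mathcal G(\mathbb R^d)$ be the set of Gaussian distributions on $\mathbb R^d$, $d_W$ the 2-Wasserstein distance, and $\Xi_d=\{(a,V)\in\mathbb R^{d\times(d+1)}: a\in\mathbb R^d,\ V\in\mathbb R^{d\times d}\text{ symmetric}\}$. For a reference measure $\mu_\ast=N(m_\ast,\Sigma_\ast)$ with $\Sigma_\ast$ non-singular, equip $\Xi_d$ with the inner product $\langle (a,V),(b,U)\rangle_{m_\ast,\Sigma_\ast}=(a+Vm_\ast)^\top(b+Um_\ast)+\mathrm{tr}(V\Sigma_\ast U)$ and its norm $\|\cdot\|_{m_\ast,\Sigma_\ast}$. For $\mu=N(m,\Sigma)$ put $\varphi_{\mu_\ast}\mu=(m-S m_\ast,\,S-I)$ with $S=\Sigma_\ast^{-1/2}[\Sigma_\ast^{1/2}\Sigma\Sigma_\ast^{1/2}]^{1/2}\Sigma_\ast^{-1/2}$, and put $\xi_{\mu_\ast}(a,V)=N(a+(V+I)m_\ast,(V+I)\Sigma_\ast(V+I))$. For a tensor $\mathbb B\in\mathbb R^{d_1\times(d_1+1)\times d_2\times(d_2+1)}$ let $\Gamma_{\mathbb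 B}(A)[r,s]=\sum_{p,q}A[p,q]\,\mathbb B[p,q,r,s]$. Let $\mathbb A^\ast$ be obtained from $\mathbb A$ by replacing each slice $\mathbb A[p,q,\cdot,\cdot]=(a,V)$ with $(a,V^\top)$. For $1\le K\le\min\{d_1,d_2\}$ let $\mathcal B_{\rm low}$ be the set of all $(\mathbb A+\mathbb A^\ast)/2$ with $\mathbb A=\sum_{k=1}^K a_1^{(k)}\circ a_2^{(k)}\circ a_3^{(k)}\circ a_4^{(k)}$ a sum of $K$ rank-one tensors. Let $\nu_{1\oplus}\in\mathcal G(\mathbb R^{d_1})$ and $\nu_{2\oplus}=N(m_{2\oplus},\Sigma_{2\oplus})\in\mathcal G(\mathbb R^{d_2})$ be known and non-singular, and set $\Gamma_{\mathcal G,\mathbb B}=\xi_{\nu_{2\oplus}}\circ\Gamma_{\mathbb B}\circ\varphi_{\nu_{1\oplus}}$. Let $\nu_{11},\dots,\nu_{1n}\in\mathcal G(\mathbb R^{d_1})$ be fixed predictors, $X_i=\varphi_{\nu_{1\oplus}}\nu_{1i}$, and let $\mathbb B_0\in\mathcal B_{\rm low}$ satisfy $\Gamma_{\mathbb B_0}(X_i)\in\varphi_{\nu_{2\oplus}}\mathcal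 G(\mathbb R^{d_2})$ for all $i$. The transformed responses (equal to $\varphi_{\nu_{2\oplus}}\nu_{2i}$ when the responses are Gaussian distributions $\nu_{2i}$) are $$Y_i=\Gamma_{\mathbb B_0}(X_i)+E_i,\qquad i=1,\dots,n,$$ where the $E_i$ are independent $\Xi_{d_2}$-valued random elements which are Gaussian (each $\langle E_i,A\rangle_{m_{2\oplus},\Sigma_{2\oplus}}$, $A\in\Xi_{d_2}$, is a real Gaussian variable, possibly degenerate), with $\mathbb E[E_i]=0$ and $\mathbb E\|E_i\|^2_{m_{2\oplus},\Sigma_{2\oplus}}=1$. **Theorem (Rank-$K$ model).** Let $\tilde{\mathbb B}\in\mathcal B_{\rm low}$ be a solution of $$\min_{\mathbb B\in\mathcal B_{\rm low}}\ \sum_{i=1}^n\|Y_i-\Gamma_{\mathbb B}(X_i)\|^2_{m_{2\oplus},\Sigma_{2\oplus}},$$ and assume $\Gamma_{\tilde{\mathbb B}}(X_i)\in\varphi_{\nu_{2\oplus}}\mathcal G(\mathbb R^{d_2})$ for $i=1,\dots,n$. Then the in-sample prediction error $$\mathcal R_n=\Big(\frac1n\sum_{i=1}^n d_W^2\big(\Gamma_{\mathcal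 G,\tilde{\mathbb B}}(\nu_{1i}),\Gamma_{\mathcal G,\mathbb B_0}(\nu_{1i})\big)\Big)^{1/2}$$ satisfies $\mathcal R_n=O_P\big(\sqrt{K(d_1+d_2)}/\sqrt n\big)$ with constants not depending on $n,d_1,d_2,K$. That is, for every $\varepsilon>0$ there is $M>0$, depending only on $\varepsilon$, such that in every such setting and for every $n\ge1$, the (outer) probability that $\tilde{\mathbb B}$ is such a solution, that it satisfies the range assumption, and that $\mathcal R_n> M\sqrt{K(d_1+d_2)}/\sqrt n$, is at most $\varepsilon$. -/

import Mathlib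

open MeasureTheory ProbabilityTheory
open scoped Matrix MatrixOrder ENNReal

universe u

namespace GaussReg

noncomputable section

/-! ### Gaussian distributions and the Wasserstein distance -/

/-- The set `𝒢(ℝ^d)` of Gaussian distributions on `ℝ^d` (singular covariances included). -/
def gaussianSpace (d : ℕ) : Set (Measure (EuclideanSpace ℝ (Fin d))) :=
  {μ | IsGaussian μ}

/-- The mean vector of a distribution on `ℝ^d`. -/
def meanVec {d : ℕ} (μ : Measure (EuclideanSpace ℝ (Fin d))) : Fin d → ℝ :=
  fun i => ∫ x, x i ∂μ

/-- The covariance matrix of a distribution on `ℝ^d`. -/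
def covMat {d : ℕ} (μ : Measure (EuclideanSpace ℝ (Fin d))) : Matrix (Fin d) (Fin d) ℝ :=
  Matrix.of fun i j => cov[fun x => x i, fun x => x j; μ]

/-- The couplings of two measures: joint measures with the prescribed marginals. -/
def couplings {d : ℕ} (μ ν : Measure (EuclideanSpace ℝ (Fin d))) :
    Set (Measure (EuclideanSpace ℝ (Fin d) × EuclideanSpace ℝ (Fin d))) :=
  {π | π.map Prod.fst = μ ∧ π.map Prod.snd = ν}

/-- The `2`-Wasserstein distance `(inf_π ∫ ‖x - y‖² dπ)^{1/2}` over couplings `π`. -/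
def wassersteinDist {d : ℕ} (μ ν : Measure (EuclideanSpace ℝ (Fin d))) : ℝ :=
  √(⨅ π ∈ couplings μ ν, ∫⁻ p, ‖p.1 - p.2‖ₑ ^ 2 ∂π).toReal

/-! ### The matrix space `Ξ_d` and the nearly isometric maps -/

/-- `d × (d+1)` real matrices, thought of as pairs `(a, V)`: column `0` is the vector `a` and
the remaining `d` columns form the square matrix `V`. -/
abbrev Mat (d : ℕ) : Type := Fin d → Fin (d + 1) → ℝ

/-- The vector `a` of `(a, V)`. -/
def vecPart {d : ℕ} (A : Mat d) : Fin d → ℝ := fun r => A r 0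

/-- The square matrix `V` of `(a, V)`. -/
def linPart {d : ℕ} (A : Mat d) : Matrix (Fin d) (Fin d) ℝ :=
  Matrix.of fun r s => A r s.succ

/-- The pair `(a, V)` as a `d × (d+1)` matrix. -/
def pair {d : ℕ} (a : Fin d → ℝ) (V : Matrix (Fin d) (Fin d) ℝ) : Mat d :=
  fun r => Fin.cons (a r) (V r)

/-- `Ξ_d`: the pairs `(a, V)` with `V` symmetric. -/
def Xi (d : ℕ) : Set (Mat d) := {A | (linPart A).IsSymm}

/-- `⟨(a,V),(b,U)⟩_{m,Σ} = (a + V m)ᵀ (b + U m) + tr(V Σ U)`. -/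
def innerXi {d : ℕ} (m : Fin d → ℝ) (S : Matrix (Fin d) (Fin d) ℝ) (A B : Mat d) : ℝ :=
  (vecPart A + linPart A *ᵥ m) ⬝ᵥ (vecPart B + linPart B *ᵥ m)
    + (linPart A * S * linPart B).trace

/-- The norm `‖(a,V)‖_{m,Σ}` induced by `innerXi`. -/
def normXi {d : ℕ} (m : Fin d → ℝ) (S : Matrix (Fin d) (Fin d) ℝ) (A : Mat d) : ℝ :=
  √(innerXi m S A A)

/-- `S(Σ₁,Σ₂) = Σ₁^{-1/2} [Σ₁^{1/2} Σ₂ Σ₁^{1/2}]^{1/2} Σ₁^{-1/2}`, the linear part of the optimal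
transport map from `N(m₁,Σ₁)` to `N(m₂,Σ₂)`. -/
def otMat {d : ℕ} (S₁ S₂ : Matrix (Fin d) (Fin d) ℝ) : Matrix (Fin d) (Fin d) ℝ :=
  (CFC.sqrt S₁)⁻¹ * CFC.sqrt (CFC.sqrt S₁ * S₂ * CFC.sqrt S₁) * (CFC.sqrt S₁)⁻¹

/-- `φ_{μ⋆} μ = (m - S(Σ⋆,Σ) m⋆, S(Σ⋆,Σ) - I)`, where `m, Σ` and `m⋆, Σ⋆` are the mean and the
covariance of `μ` and of the reference measure `μ⋆`. -/
def phi {d : ℕ} (ref μ : Measure (EuclideanSpace ℝ (Fin d))) : Mat d :=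
  pair (meanVec μ - otMat (covMat ref) (covMat μ) *ᵥ meanVec ref)
    (otMat (covMat ref) (covMat μ) - 1)

/-- `ξ_{μ⋆} (a,V) = N(a + (V + I) m⋆, (V + I) Σ⋆ (V + I))`. -/
def xi {d : ℕ} (ref : Measure (EuclideanSpace ℝ (Fin d))) (A : Mat d) :
    Measure (EuclideanSpace ℝ (Fin d)) :=
  multivariateGaussian (WithLp.toLp 2 (vecPart A + (linPart A + 1) *ᵥ meanVec ref))
    ((linPart A + 1) * covMat ref * (linPart A + 1))

/-! ### Coefficient tensors and the regression maps -/

/-- Real tensors of size `d₁ × (d₁+1) × d₂ × (d₂+1)`. -/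
abbrev Tensor (d₁ d₂ : ℕ) : Type := Fin d₁ → Fin (d₁ + 1) → Fin d₂ → Fin (d₂ + 1) → ℝ

/-- `Γ_𝔹(A) = ⟨A, 𝔹⟩₂`, i.e. `Γ_𝔹(A)[r,s] = ∑_{p,q} A[p,q] 𝔹[p,q,r,s]`. -/
def Gam {d₁ d₂ : ℕ} (B : Tensor d₁ d₂) (A : Mat d₁) : Mat d₂ :=
  fun r s => ∑ p, ∑ q, A p q * B p q r s

/-- `C ↦ C^*`, which keeps the first column and transposes the remaining square block. -/
def starMat {d : ℕ} (C : Mat d) : Mat d := pair (vecPart C) (linPart C)ᵀ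

/-- `𝔸 ↦ 𝔸^*`, with `𝔸^*[p,q,·,·] = 𝔸[p,q,·,·]^*`. -/
def starTensor {d₁ d₂ : ℕ} (A : Tensor d₁ d₂) : Tensor d₁ d₂ := fun p q => starMat (A p q)

/-- `𝔸` has a rank-`K` (CP) decomposition `∑_{k=1}^K a₁ᵏ ∘ a₂ᵏ ∘ a₃ᵏ ∘ a₄ᵏ`. -/
def HasRankDecomp {d₁ d₂ : ℕ} (K : ℕ) (A : Tensor d₁ d₂) : Prop :=
  ∃ (a₁ : Fin K → Fin d₁ → ℝ) (a₂ : Fin K → Fin (d₁ + 1) → ℝ)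
    (a₃ : Fin K → Fin d₂ → ℝ) (a₄ : Fin K → Fin (d₂ + 1) → ℝ),
    ∀ p q r s, A p q r s = ∑ k, a₁ k p * a₂ k q * a₃ k r * a₄ k s

/-- `ℬ_low`: the tensors `(𝔸 + 𝔸^*)/2` with `𝔸` having a rank-`K` decomposition. -/
def lowRank (d₁ d₂ K : ℕ) : Set (Tensor d₁ d₂) :=
  {B | ∃ A : Tensor d₁ d₂, HasRankDecomp K A ∧ B = (2⁻¹ : ℝ) • (A + starTensor A)}

/-- `Γ_{𝒢,𝔹} = ξ_{ν₂⊕} ∘ Γ_𝔹 ∘ φ_{ν₁⊕}`. -/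
def GamG {d₁ d₂ : ℕ} (ref₁ : Measure (EuclideanSpace ℝ (Fin d₁)))
    (ref₂ : Measure (EuclideanSpace ℝ (Fin d₂))) (B : Tensor d₁ d₂)
    (ν : Measure (EuclideanSpace ℝ (Fin d₁))) : Measure (EuclideanSpace ℝ (Fin d₂)) :=
  xi ref₂ (Gam B (phi ref₁ ν))

/-- `𝔹` minimises `∑_i ‖Y_i - Γ_𝔹(X_i)‖²_{m,Σ}` over the class `𝓑`. -/
def IsLeastSquares {d₁ d₂ n : ℕ} (𝓑 : Set (Tensor d₁ d₂)) (m : Fin d₂ → ℝ)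
    (S : Matrix (Fin d₂) (Fin d₂) ℝ) (X : Fin n → Mat d₁) (Y : Fin n → Mat d₂)
    (B : Tensor d₁ d₂) : Prop :=
  B ∈ 𝓑 ∧ IsMinOn (fun B' => ∑ i, normXi m S (Y i - Gam B' (X i)) ^ 2) 𝓑 B

/-- The in-sample prediction error
`√(n⁻¹ ∑_i d_W²(Γ_{𝒢,𝔹}(ν_{1i}), Γ_{𝒢,𝔹'}(ν_{1i})))`. -/
def predError {d₁ d₂ n : ℕ} (ref₁ : Measure (EuclideanSpace ℝ (Fin d₁)))
    (ref₂ : Measure (EuclideanSpace ℝ (Fin d₂)))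
    (ν₁ : Fin n → Measure (EuclideanSpace ℝ (Fin d₁))) (B B' : Tensor d₁ d₂) : ℝ :=
  √((1 / (n : ℝ)) *
    ∑ i, wassersteinDist (GamG ref₁ ref₂ B (ν₁ i)) (GamG ref₁ ref₂ B' (ν₁ i)) ^ 2)

/-- `E` is a centred Gaussian random element of `(Ξ_d, ⟨·,·⟩_{m,Σ})` whose covariance has
trace `1`: every `⟨E, A⟩_{m,Σ}` with `A ∈ Ξ_d` is a (possibly degenerate) real Gaussian variable,
`𝔼[E] = 0` and `𝔼‖E‖² = 1`. -/
structure IsGaussianNoise {d : ℕ} {Ω : Type u} [MeasurableSpace Ω] (P : Measure Ω)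
    (m : Fin d → ℝ) (S : Matrix (Fin d) (Fin d) ℝ) (E : Ω → Mat d) : Prop where
  measurable : Measurable E
  mem : ∀ ω, E ω ∈ Xi d
  gaussian : ∀ A ∈ Xi d, HasGaussianLaw (fun ω => innerXi m S (E ω) A) P
  mean_zero : ∀ r s, ∫ ω, E ω r s ∂P = 0
  trace_one : ∫ ω, normXi m S (E ω) ^ 2 ∂P = 1

end

end GaussReg

/-! Minimality of the estimator gives the basic inequality `‖δ‖² ≤ 2⟨E, δ⟩`, where `δ` is the
stacked vector of the differences between fitted and true signals. Hence `‖δ‖²` is at most `4 ⟨E,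
δ⟩² / ‖δ‖²` when `δ ≠ 0`, and it suffices to bound this ratio uniformly over all possible `δ`. The
Wasserstein error is controlled by `‖δ‖`, because pushing the reference measure through two affine
maps at once couples their images (`wassersteinDist_xi_le`).

A difference of two rank-`K` tensors has rank at most `2K`, so `δ = F θ` with `F` a quartic form in
`p = 2K(2d₁ + 2d₂ + 2)` parameters. The noise is Gaussian with covariance at most the identity,
since the trace of each block is `1` and the blocks are independent. What remains is a maximal
inequality: `sup_θ ⟨x, F θ⟩² / ‖F θ‖²` is of order `p`, whatever the ambient dimension
(`pi_gaussianReal_sup_le`, `gaussian_sup_le`).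

This is proved by the moment method with a polynomial kernel instead of a covering argument. The
power `⟨z, u⟩ ^ q` is an inner product of degree-`q` feature vectors. For `u = F θ` the features are
forms of degree `D q` in `p` variables, so they span a space `W` of dimension at most `2 ^ (p + D
q)`. For `z` complex Gaussian the monomials are orthogonal, and Cauchy–Schwarz in `W` gives `E sup
|⟨z, u⟩| ^ (2q) / ‖u‖ ^ (2q) ≤ dim W * 2 ^ q * q!`. Markov's inequality with `q = p` yields a tail
`(2 ^ (D + 2) / t) ^ p` at level `t p`. -/

namespace GaussReg

/-! ### Moments of a complex Gaussian variable -/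

/-- The standard Gaussian measure on the plane, the law of a standard complex Gaussian variable
up to the identification of `ℝ × ℝ` with `ℂ`. -/
noncomputable def planeGaussian : Measure (ℝ × ℝ) := (gaussianReal 0 1).prod (gaussianReal 0 1)

instance : IsProbabilityMeasure planeGaussian := by unfold planeGaussian; infer_instance

instance : IsGaussian planeGaussian := by unfold planeGaussian; infer_instance

/-- The complex number with prescribed real and imaginary part. -/
noncomputable def toC (p : ℝ × ℝ) : ℂ := p.1 + p.2 * Complex.I

lemma measurable_toC : Measurable toC := by unfold toC; fun_prop

lemma norm_toC_le (p : ℝ × ℝ) : ‖toC p‖ ≤ 2 * ‖p‖ := by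
  have h1 : ‖p.1‖ ≤ ‖p‖ := norm_fst_le p
  have h2 : ‖p.2‖ ≤ ‖p‖ := norm_snd_le p
  calc ‖toC p‖ ≤ ‖(p.1 : ℂ)‖ + ‖(p.2 : ℂ) * Complex.I‖ := norm_add_le _ _
    _ = ‖p.1‖ + ‖p.2‖ := by simp
    _ ≤ _ := by linarith

lemma integrable_toC_pow_mul_conj (a b : ℕ) :
    Integrable (fun p => toC p ^ a * (starRingEnd ℂ) (toC p) ^ b) planeGaussian := by
  have h := (IsGaussian.memLp_id planeGaussian ((a + b : ℕ) : ℝ≥0∞) (by simp)).integrable_norm_pow'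
  refine (h.const_mul (2 ^ (a + b))).mono' ?_ (Filter.Eventually.of_forall fun p => ?_)
  · have := measurable_toC
    exact Measurable.aestronglyMeasurable (by fun_prop)
  · rw [norm_mul, norm_pow, norm_pow, RCLike.norm_conj, ← pow_add, ← mul_pow]
    exact pow_le_pow_left₀ (norm_nonneg _) (norm_toC_le p) _

lemma integral_exp_int_mul_Ioo (k : ℤ) :
    ∫ θ in Set.Ioo (-Real.pi) Real.pi, Complex.exp (k * θ * Complex.I)
      = if k = 0 then (2 * Real.pi : ℂ) else 0 := by
  rw [← integral_Ioc_eq_integral_Ioo, ← intervalIntegral.integral_of_le (by linarith [Real.pi_pos])]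
  split_ifs with h
  · subst h; simp; ring
  · have hk : (k : ℂ) * Complex.I ≠ 0 := by simp [h]
    have := integral_exp_mul_complex (a := -Real.pi) (b := Real.pi) hk
    simp_rw [show ∀ x : ℝ, (k : ℂ) * x * Complex.I = k * Complex.I * x by intro x; ring]
    rw [this, div_eq_zero_iff]
    left
    rw [sub_eq_zero, Complex.exp_eq_exp_iff_exists_int]
    exact ⟨k, by push_cast; ring⟩

lemma integral_pow_mul_exp_neg_sq_div_two (a : ℕ) :
    ∫ r in Set.Ioi (0 : ℝ), r ^ (2 * a + 1) * Real.exp (-(r ^ 2) / 2) = 2 ^ a * a.factorial := by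
  have h := integral_rpow_mul_exp_neg_mul_rpow (p := 2) (q := 2 * a + 1) (b := 1 / 2)
    (by norm_num) (by have := a.cast_nonneg (α := ℝ); linarith) (by norm_num)
  rw [show (2 * (a : ℝ) + 1 + 1) / 2 = a + 1 by ring, Real.Gamma_nat_eq_factorial,
    show -(2 * (a : ℝ) + 1 + 1) / 2 = -((a + 1 : ℕ) : ℝ) by push_cast; ring,
    Real.rpow_neg (by norm_num), Real.rpow_natCast] at h
  convert h using 1
  · refine setIntegral_congr_fun measurableSet_Ioi fun r _ => ?_
    rw [show (2 * (a : ℝ) + 1) = ((2 * a + 1 : ℕ) : ℝ) by push_cast; ring, Real.rpow_natCast,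
      show r ^ (2 : ℝ) = r ^ 2 from Real.rpow_natCast r 2]
    congr 2; ring
  · rw [one_div, inv_pow, inv_inv, pow_succ]; ring

/-- In polar coordinates the angular integral of `exp (i (a - b) θ)` vanishes unless `a = b`. This
orthogonality of distinct powers fails for real Gaussians and is the reason for complexifying. The
normalisation is `E|z|² = 2`, whence the factor `2 ^ a`. -/
lemma integral_toC_pow_mul_conj (a b : ℕ) :
    ∫ p, toC p ^ a * (starRingEnd ℂ) (toC p) ^ b ∂planeGaussian
      = if a = b then (2 ^ a * a.factorial : ℂ) else 0 := by
  have hd : planeGaussian = (volume : Measure (ℝ × ℝ)).withDensity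
      (fun z => gaussianPDF 0 1 z.1 * gaussianPDF 0 1 z.2) := by
    rw [planeGaussian, gaussianReal_of_var_ne_zero 0 one_ne_zero,
      prod_withDensity (measurable_gaussianPDF _ _) (measurable_gaussianPDF _ _)]
    rfl
  have hm := measurable_gaussianPDF 0 1
  rw [hd, integral_withDensity_eq_integral_toReal_smul (by fun_prop)
    (Filter.Eventually.of_forall fun z => ENNReal.mul_lt_top gaussianPDF_lt_top gaussianPDF_lt_top),
    ← integral_comp_polarCoord_symm, polarCoord_target]
  have key : ∀ z ∈ Set.Ioi (0 : ℝ) ×ˢ Set.Ioo (-Real.pi) Real.pi,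
      z.1 • ((gaussianPDF 0 1 (polarCoord.symm z).1 * gaussianPDF 0 1 (polarCoord.symm z).2).toReal •
        (toC (polarCoord.symm z) ^ a * (starRingEnd ℂ) (toC (polarCoord.symm z)) ^ b))
      = ((2 * Real.pi)⁻¹ * (z.1 ^ (a + b + 1) * Real.exp (-(z.1 ^ 2) / 2)) : ℝ)
        * Complex.exp (((a : ℤ) - (b : ℤ) : ℤ) * z.2 * Complex.I) := by
    rintro ⟨r, θ⟩ -
    have hz : toC (polarCoord.symm (r, θ)) = r * Complex.exp (θ * Complex.I) := by
      simp only [toC, polarCoord_symm_apply]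
      rw [Complex.exp_mul_I]; push_cast; ring
    have hc : (starRingEnd ℂ) (Complex.exp (θ * Complex.I)) = Complex.exp (-(θ * Complex.I)) := by
      rw [← Complex.exp_conj]; simp
    have hp : (gaussianPDF 0 1 (polarCoord.symm (r, θ)).1 *
        gaussianPDF 0 1 (polarCoord.symm (r, θ)).2).toReal
        = (2 * Real.pi)⁻¹ * Real.exp (-(r ^ 2) / 2) := by
      rw [ENNReal.toReal_mul, toReal_gaussianPDF, toReal_gaussianPDF]
      simp only [gaussianPDFReal, polarCoord_symm_apply]
      rw [mul_mul_mul_comm, ← mul_inv, ← Real.exp_add]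
      simp only [NNReal.coe_one, mul_one, sub_zero]
      rw [Real.mul_self_sqrt (by positivity)]
      congr 2
      have := Real.sin_sq_add_cos_sq θ
      linear_combination (-(r ^ 2) / 2) * this
    rw [hz, hp, map_mul, hc, mul_pow, mul_pow, ← Complex.exp_nat_mul, ← Complex.exp_nat_mul,
      Complex.conj_ofReal, Complex.real_smul, Complex.real_smul]
    have : Complex.exp (((a : ℤ) - (b : ℤ) : ℤ) * θ * Complex.I)
        = Complex.exp (a * (θ * Complex.I)) * Complex.exp (b * -(θ * Complex.I)) := by
      rw [← Complex.exp_add]; congr 1; push_cast; ring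
    simp only [this]
    push_cast
    ring
  rw [setIntegral_congr_fun (measurableSet_Ioi.prod measurableSet_Ioo) key, Measure.volume_eq_prod,
    setIntegral_prod_mul (fun r : ℝ => (((2 * Real.pi)⁻¹ *
      (r ^ (a + b + 1) * Real.exp (-(r ^ 2) / 2)) : ℝ) : ℂ))
      (fun θ : ℝ => Complex.exp (((a : ℤ) - (b : ℤ) : ℤ) * θ * Complex.I)),
    integral_exp_int_mul_Ioo]
  by_cases h : a = b
  · subst h
    rw [integral_complex_ofReal, integral_const_mul, ← two_mul, integral_pow_mul_exp_neg_sq_div_two]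
    have := Real.pi_ne_zero
    simp
    field_simp
  · rw [if_neg h, if_neg (by omega), mul_zero]

/-! ### Polynomial features and the maximal inequality on a feature subspace -/

section Features

variable {ι : Type*} [Fintype ι] [DecidableEq ι]

/-- The law of a vector of independent standard complex Gaussian variables. -/
noncomputable def complexGaussian (ι : Type*) [Fintype ι] : Measure (ι → ℝ × ℝ) :=
  Measure.pi fun _ => planeGaussian

instance : IsProbabilityMeasure (complexGaussian ι) := by unfold complexGaussian; infer_instance

/-- The multi-indices of length `q`. -/
abbrev MultiIdx (ι : Type*) [Fintype ι] [DecidableEq ι] (q : ℕ) : Type _ :=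
  (Finset.univ : Finset ι).piAntidiag q

/-- The weighted monomials of degree `q`, normalised so that the multinomial theorem reads
`⟨u, v⟩ ^ q = ∑ α, feature α u * feature α v`. -/
noncomputable def feature {R : Type*} [CommSemiring R] [Algebra ℝ R] {q : ℕ} (α : MultiIdx ι q)
    (u : ι → R) : R :=
  algebraMap ℝ R √(Nat.multinomial Finset.univ α.1) * ∏ i, u i ^ α.1 i

lemma sum_mul_pow_eq_sum_feature (q : ℕ) (z : ι → ℂ) (u : ι → ℝ) :
    (∑ i, z i * u i) ^ q = ∑ α : MultiIdx ι q, feature α z * (feature α u : ℝ) := by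
  rw [Finset.sum_pow_eq_sum_piAntidiag, ← Finset.sum_coe_sort]
  refine Finset.sum_congr rfl fun α _ => ?_
  have h : ((√(Nat.multinomial Finset.univ α.1) : ℝ) : ℂ) * (√(Nat.multinomial Finset.univ α.1) : ℝ)
      = Nat.multinomial Finset.univ α.1 := by
    rw [← Complex.ofReal_mul, Real.mul_self_sqrt (by positivity)]; simp
  simp only [feature, mul_pow, Finset.prod_mul_distrib, Complex.coe_algebraMap,
    Algebra.algebraMap_self, RingHom.id_apply, Complex.ofReal_mul, Complex.ofReal_prod,
    Complex.ofReal_pow]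
  rw [← h]; ring

lemma sum_feature_sq (q : ℕ) (u : ι → ℝ) :
    ∑ α : MultiIdx ι q, feature α u ^ 2 = (∑ i, u i ^ 2) ^ q := by
  have h := sum_mul_pow_eq_sum_feature q (fun i => (u i : ℂ)) u
  have h2 : ∀ α : MultiIdx ι q, feature α (fun i => (u i : ℂ)) = (feature α u : ℝ) := by
    intro α; simp [feature]
  simp_rw [h2, ← Complex.ofReal_mul, ← Complex.ofReal_sum, ← Complex.ofReal_pow] at h
  have := Complex.ofReal_injective h
  simpa [sq] using this.symm

lemma integrable_feature_mul_conj {q : ℕ} (α β : MultiIdx ι q) :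
    Integrable (fun p => feature α (fun i => toC (p i)) *
      (starRingEnd ℂ) (feature β (fun i => toC (p i)))) (complexGaussian ι) := by
  have h := (Integrable.fintype_prod (f := fun i p => toC p ^ α.1 i * (starRingEnd ℂ) (toC p) ^ β.1 i)
    (μ := fun _ : ι => planeGaussian) (fun i => integrable_toC_pow_mul_conj _ _)).const_mul
    (((√(Nat.multinomial Finset.univ α.1) : ℝ) : ℂ) * (√(Nat.multinomial Finset.univ β.1) : ℝ))
  refine h.congr (Filter.Eventually.of_forall fun p => ?_)
  simp only [feature, Finset.prod_mul_distrib, map_mul, map_prod, map_pow, Complex.coe_algebraMap,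
    Complex.conj_ofReal]
  ring

/-- By independence the integral factors over coordinates, and one differing exponent kills it. On
the diagonal the multinomial weight cancels `∏ α_i!` into `q!`, so all features have the same second
moment. -/
lemma integral_feature_mul_conj {q : ℕ} (α β : MultiIdx ι q) :
    ∫ p, feature α (fun i => toC (p i)) * (starRingEnd ℂ) (feature β (fun i => toC (p i)))
        ∂complexGaussian ι = if α = β then (2 ^ q * q.factorial : ℂ) else 0 := by
  have h : ∀ p : ι → ℝ × ℝ, feature α (fun i => toC (p i)) *
      (starRingEnd ℂ) (feature β (fun i => toC (p i)))
      = (((√(Nat.multinomial Finset.univ α.1) : ℝ) : ℂ) * (√(Nat.multinomial Finset.univ β.1) : ℝ)) *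
        ∏ i, (toC (p i) ^ α.1 i * (starRingEnd ℂ) (toC (p i)) ^ β.1 i) := by
    intro p
    simp only [feature, Finset.prod_mul_distrib, map_mul, map_prod, map_pow, Complex.coe_algebraMap,
      Complex.conj_ofReal]
    ring
  simp_rw [h]
  rw [integral_const_mul, complexGaussian,
    integral_fintype_prod_eq_prod (fun i p => toC p ^ α.1 i * (starRingEnd ℂ) (toC p) ^ β.1 i)]
  simp_rw [integral_toC_pow_mul_conj]
  split_ifs with hab
  · subst hab
    have hq : ∑ i, α.1 i = q := (Finset.mem_piAntidiag.1 α.2).1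
    have hs := Nat.multinomial_spec Finset.univ α.1
    rw [← Complex.ofReal_mul, Real.mul_self_sqrt (by positivity)]
    simp only [if_true, Finset.prod_mul_distrib]
    rw [Finset.prod_pow_eq_pow_sum, hq]
    rw [hq] at hs
    rw [← hs]; push_cast; ring
  · obtain ⟨i, hi⟩ : ∃ i, α.1 i ≠ β.1 i := by
      by_contra! hc; exact hab (Subtype.ext (funext hc))
    rw [Finset.prod_eq_zero (Finset.mem_univ i) (by rw [if_neg hi]), mul_zero]

/-- The random linear form `w ↦ ∑ α, Z_α w_α` in the monomials of a complex Gaussian vector. -/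
noncomputable def gaussForm {q : ℕ} (w : MultiIdx ι q → ℝ) (p : ι → ℝ × ℝ) : ℂ :=
  ∑ α, feature α (fun i => toC (p i)) * w α

lemma normSq_gaussForm {q : ℕ} (w : MultiIdx ι q → ℝ) (p : ι → ℝ × ℝ) :
    ((‖gaussForm w p‖ ^ 2 : ℝ) : ℂ) = ∑ α, ∑ β, (w α * w β : ℂ) *
      (feature α (fun i => toC (p i)) * (starRingEnd ℂ) (feature β (fun i => toC (p i)))) := by
  rw [Complex.ofReal_pow, ← Complex.mul_conj', gaussForm, map_sum, Finset.sum_mul_sum]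
  refine Finset.sum_congr rfl fun α _ => Finset.sum_congr rfl fun β _ => ?_
  rw [map_mul, Complex.conj_ofReal]; ring

lemma integrable_normSq_gaussForm {q : ℕ} (w : MultiIdx ι q → ℝ) :
    Integrable (fun p => ‖gaussForm w p‖ ^ 2) (complexGaussian ι) := by
  have : Integrable (fun p => ((‖gaussForm w p‖ ^ 2 : ℝ) : ℂ)) (complexGaussian ι) := by
    simp_rw [normSq_gaussForm]
    exact integrable_finsetSum _ fun α _ => integrable_finsetSum _ fun β _ =>
      (integrable_feature_mul_conj α β).const_mul _
  exact this.re.congr (Filter.Eventually.of_forall fun p => Complex.ofReal_re _)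

lemma integral_normSq_gaussForm {q : ℕ} (w : MultiIdx ι q → ℝ) :
    ∫ p, ‖gaussForm w p‖ ^ 2 ∂complexGaussian ι = 2 ^ q * q.factorial * ∑ α, w α ^ 2 := by
  apply Complex.ofReal_injective
  rw [← integral_complex_ofReal]
  simp_rw [normSq_gaussForm]
  rw [integral_finsetSum _ fun α _ => integrable_finsetSum _ fun β _ =>
      (integrable_feature_mul_conj α β).const_mul _]
  simp_rw [integral_finsetSum _ fun β _ => (integrable_feature_mul_conj _ β).const_mul _,
    integral_const_mul, integral_feature_mul_conj]
  simp [Finset.mul_sum, sq, mul_comm]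

/-- Maximal inequality for powers of a complex Gaussian process: if the degree-`q` features of
all the vectors of `T` lie in `W`, then `sup_{u ∈ T} |⟨z, u⟩| ^ (2 q) / ‖u‖ ^ (2 q)` has weak
first moment at most `dim W * 2 ^ q * q!`. -/
lemma complexGaussian_sup_le {q : ℕ} (T : Set (ι → ℝ))
    (W : Submodule ℝ (EuclideanSpace ℝ (MultiIdx ι q)))
    (hW : ∀ u ∈ T, WithLp.toLp 2 (fun α : MultiIdx ι q => feature α u) ∈ W) {c : ℝ} (hc : 0 < c) :
    complexGaussian ι {p | ∃ u ∈ T, c * (∑ i, u i ^ 2) ^ q < ‖∑ i, toC (p i) * u i‖ ^ (2 * q)}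
      ≤ ENNReal.ofReal (Module.finrank ℝ W * (2 ^ q * q.factorial) / c) := by
  set b := stdOrthonormalBasis ℝ W
  set v : Fin (Module.finrank ℝ W) → MultiIdx ι q → ℝ :=
    fun j α => (b j : EuclideanSpace ℝ (MultiIdx ι q)) α with hv
  set Q : (ι → ℝ × ℝ) → ℝ := fun p => ∑ j, ‖gaussForm (v j) p‖ ^ 2
  have hQint : Integrable Q (complexGaussian ι) :=
    integrable_finsetSum _ fun j _ => integrable_normSq_gaussForm _
  have hQ : ∫ p, Q p ∂complexGaussian ι = Module.finrank ℝ W * (2 ^ q * q.factorial) := by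
    simp only [Q]
    rw [integral_finsetSum _ fun j _ => integrable_normSq_gaussForm _]
    simp_rw [integral_normSq_gaussForm]
    have : ∀ j, ∑ α, v j α ^ 2 = 1 := by
      intro j
      rw [hv, ← EuclideanSpace.real_norm_sq_eq, ← Submodule.coe_norm, b.orthonormal.1 j, one_pow]
    simp_rw [this]
    simp
  have hQ0 : ∀ p, 0 ≤ Q p := fun p => Finset.sum_nonneg fun j _ => by positivity
  -- Expanding the features of `u` in an orthonormal basis of `W` and applying Cauchy–Schwarz
  -- separates `u` from `z`: the single variable `Q` dominates the ratio for every `u ∈ T` at once.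
  have hsub : {p | ∃ u ∈ T, c * (∑ i, u i ^ 2) ^ q < ‖∑ i, toC (p i) * u i‖ ^ (2 * q)}
      ⊆ {p | c ≤ Q p} := by
    rintro p ⟨u, hu, hlt⟩
    set f : W := ⟨_, hW u hu⟩
    have hf : ∀ α : MultiIdx ι q, feature α u = ∑ j, b.repr f j * v j α := by
      intro α
      have := congrArg (fun x : W => (x : EuclideanSpace ℝ (MultiIdx ι q)) α) (b.sum_repr f)
      simp only at this
      rw [show feature α u = (f : EuclideanSpace ℝ (MultiIdx ι q)) α from rfl, ← this]
      simp [hv]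
    have hpow : (∑ i, toC (p i) * u i) ^ q
        = ∑ j, (b.repr f j : ℂ) * gaussForm (v j) p := by
      rw [sum_mul_pow_eq_sum_feature]
      simp only [gaussForm, hf, Complex.ofReal_sum, Complex.ofReal_mul, Finset.mul_sum]
      rw [Finset.sum_comm]
      exact Finset.sum_congr rfl fun _ _ => Finset.sum_congr rfl fun _ _ => by ring
    have hnorm : ∑ j, b.repr f j ^ 2 = (∑ i, u i ^ 2) ^ q := by
      rw [← sum_feature_sq, ← EuclideanSpace.real_norm_sq_eq, LinearIsometryEquiv.norm_map,
        Submodule.coe_norm, EuclideanSpace.real_norm_sq_eq]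
    have hcs : ‖∑ i, toC (p i) * u i‖ ^ (2 * q) ≤ (∑ i, u i ^ 2) ^ q * Q p := by
      rw [mul_comm 2 q, pow_mul, ← norm_pow, hpow, ← hnorm]
      calc _ ≤ (∑ j, |b.repr f j| * ‖gaussForm (v j) p‖) ^ 2 := by
            gcongr
            refine (norm_sum_le _ _).trans (Finset.sum_le_sum fun j _ => ?_)
            rw [norm_mul, Complex.norm_real, Real.norm_eq_abs]
        _ ≤ (∑ j, |b.repr f j| ^ 2) * Q p := Finset.sum_mul_sq_le_sq_mul_sq _ _ _
        _ = _ := by simp only [sq_abs]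
    have h0 : 0 ≤ (∑ i, u i ^ 2) ^ q := pow_nonneg (Finset.sum_nonneg fun i _ => sq_nonneg _) _
    by_contra hlt'
    simp only [Set.mem_ofPred_eq, not_le] at hlt'
    nlinarith
  have hM := mul_meas_ge_le_integral_of_nonneg (Filter.Eventually.of_forall hQ0) hQint c
  rw [hQ, mul_comm, ← le_div_iff₀ hc] at hM
  refine (measure_mono hsub).trans ?_
  rw [← ENNReal.ofReal_toReal (measure_ne_top (complexGaussian ι) {p | c ≤ Q p})]
  exact ENNReal.ofReal_le_ofReal hM

end Features

/-! ### Gaussian suprema over the image of a homogeneous polynomial map -/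

section Polynomial

variable {ι σ : Type*} [Fintype ι] [DecidableEq ι]

lemma isHomogeneous_feature {D q : ℕ} (F : ι → MvPolynomial σ ℝ) (hF : ∀ i, (F i).IsHomogeneous D)
    (α : MultiIdx ι q) : (feature α F).IsHomogeneous (D * q) := by
  have h := MvPolynomial.IsHomogeneous.prod Finset.univ (fun i => F i ^ α.1 i)
    (fun i => D * α.1 i) (fun i _ => (hF i).pow (α.1 i))
  rw [← Finset.mul_sum, (Finset.mem_piAntidiag.1 α.2).1] at h
  simpa [feature] using (MvPolynomial.isHomogeneous_C σ _).mul h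

lemma eval_feature {q : ℕ} (F : ι → MvPolynomial σ ℝ) (α : MultiIdx ι q) (θ : σ → ℝ) :
    MvPolynomial.eval θ (feature α F) = feature α (fun i => MvPolynomial.eval θ (F i)) := by
  simp [feature, MvPolynomial.algebraMap_eq]

variable [Fintype σ] [DecidableEq σ]

/-- The features of a homogeneous polynomial map of degree `D` in `p` variables span a space of
dimension at most `2 ^ (p + D q)`, whatever the dimension of the target. -/
lemma exists_submodule_feature_mem {D q : ℕ} (F : ι → MvPolynomial σ ℝ)
    (hF : ∀ i, (F i).IsHomogeneous D) :
    ∃ W : Submodule ℝ (EuclideanSpace ℝ (MultiIdx ι q)),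
      Module.finrank ℝ W ≤ 2 ^ (Fintype.card σ + D * q) ∧
      ∀ θ : σ → ℝ, WithLp.toLp 2
        (fun α : MultiIdx ι q => feature α (fun i => MvPolynomial.eval θ (F i))) ∈ W := by
  set S := (Finset.univ : Finset σ).finsuppAntidiag (D * q)
  set v : (σ →₀ ℕ) → EuclideanSpace ℝ (MultiIdx ι q) :=
    fun β => WithLp.toLp 2 fun α => (feature α F).coeff β
  refine ⟨Submodule.span ℝ ((S.image v : Finset _) : Set _), ?_, fun θ => ?_⟩
  · refine (finrank_span_finset_le_card _).trans (Finset.card_image_le.trans ?_)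
    rw [Finset.card_finsuppAntidiag_nat_eq_choose]
    refine (Nat.choose_le_two_pow _ _).trans (Nat.pow_le_pow_right (by norm_num) ?_)
    simp
  -- Each feature of `F` is a form of degree `D * q`, so the feature vector of `F θ` is a
  -- combination of coefficient vectors `v β`, one for each monomial of that degree.
  · have : WithLp.toLp 2
        (fun α : MultiIdx ι q => feature α (fun i => MvPolynomial.eval θ (F i)))
        = ∑ β ∈ S, (∏ i, θ i ^ β i) • v β := by
      ext α
      have hsub : (feature α F).support ⊆ S := by
        intro β hβ
        have := isHomogeneous_feature F hF α (MvPolynomial.mem_support_iff.1 hβ)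
        rw [Finset.mem_finsuppAntidiag]
        refine ⟨?_, by simp⟩
        rw [Finsupp.weight_apply] at this
        simpa [Finsupp.sum_fintype] using this
      simp only [WithLp.ofLp_sum, WithLp.ofLp_smul, Finset.sum_apply, Pi.smul_apply, smul_eq_mul, v]
      rw [← eval_feature, MvPolynomial.eval_eq', Finset.sum_subset hsub]
      · exact Finset.sum_congr rfl fun _ _ => mul_comm _ _
      · intro β _ hβ
        rw [MvPolynomial.notMem_support_iff.1 hβ, zero_mul]
    rw [this]
    exact Submodule.sum_mem _ fun β hβ => Submodule.smul_mem _ _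
      (Submodule.subset_span (by simpa using ⟨β, hβ, rfl⟩))

/-- For a homogeneous polynomial map `F` of degree `D` in `p` variables and a standard Gaussian
vector `x`, the normalised supremum of `⟨x, F θ⟩ ^ 2` is of order `p`. -/
lemma pi_gaussianReal_sup_le {D : ℕ} (F : ι → MvPolynomial σ ℝ)
    (hF : ∀ i, (F i).IsHomogeneous D) (hσ : 0 < Fintype.card σ) {t : ℝ} (ht : 0 < t) :
    Measure.pi (fun _ : ι => gaussianReal 0 1) {x | ∃ θ : σ → ℝ,
        t * Fintype.card σ * ∑ i, MvPolynomial.eval θ (F i) ^ 2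
          < (∑ i, x i * MvPolynomial.eval θ (F i)) ^ 2}
      ≤ ENNReal.ofReal ((2 ^ (D + 2) / t) ^ Fintype.card σ) := by
  set p := Fintype.card σ
  set A := {x : ι → ℝ | ∃ θ : σ → ℝ, t * p * ∑ i, MvPolynomial.eval θ (F i) ^ 2
          < (∑ i, x i * MvPolynomial.eval θ (F i)) ^ 2}
  have hmp : MeasurePreserving (fun (z : ι → ℝ × ℝ) i => (z i).1) (complexGaussian ι)
      (Measure.pi (fun _ : ι => gaussianReal 0 1)) :=
    measurePreserving_pi _ _ fun _ => measurePreserving_fst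
  rw [← hmp.map_eq]
  -- The union over `θ` is uncountable, but each piece is open.
  have hA : MeasurableSet A := by
    have : A = ⋃ θ : σ → ℝ, {x : ι → ℝ | t * p * ∑ i, MvPolynomial.eval θ (F i) ^ 2
          < (∑ i, x i * MvPolynomial.eval θ (F i)) ^ 2} := by ext x; simp [A]
    rw [this]
    exact (isOpen_iUnion fun θ => isOpen_lt continuous_const (by fun_prop)).measurableSet
  rw [Measure.map_apply hmp.measurable hA]
  -- The choice `q = p` balances the terms: `dim W` is exponential in `p`, and `p! ≤ p ^ p` is
  -- absorbed by the factor `p ^ p` of the threshold `(t * p) ^ p`.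
  obtain ⟨W, hdim, hW⟩ := exists_submodule_feature_mem (q := p) F hF
  have htp : 0 < t * p := by positivity
  have hsup := complexGaussian_sup_le
    (Set.range fun (θ : σ → ℝ) i => MvPolynomial.eval θ (F i)) W
    (by rintro _ ⟨θ, rfl⟩; exact hW θ) (pow_pos htp p)
  refine (measure_mono ?_).trans (hsup.trans (ENNReal.ofReal_le_ofReal ?_))
  · rintro z ⟨θ, hθ⟩
    refine ⟨_, ⟨θ, rfl⟩, ?_⟩
    rw [← mul_pow, pow_mul]
    refine pow_lt_pow_left₀ (hθ.trans_le ?_)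
      (mul_nonneg htp.le (Finset.sum_nonneg fun i _ => sq_nonneg _)) hσ.ne'
    -- The real Gaussian vector is the real part of the complex one, so passing to the modulus only
    -- enlarges the event.
    have hre : (∑ i, toC (z i) * (MvPolynomial.eval θ (F i) : ℝ)).re
        = ∑ i, (z i).1 * MvPolynomial.eval θ (F i) := by
      simp [toC]
    rw [← hre, ← sq_abs]
    gcongr
    exact Complex.abs_re_le_norm _
  · rw [div_pow, mul_pow, div_le_div_iff₀ (by positivity) (by positivity)]
    have h1 : (Module.finrank ℝ W : ℝ) ≤ 2 ^ (p + D * p) := by exact_mod_cast hdim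
    have h2 : (p.factorial : ℝ) ≤ (p : ℝ) ^ p := by exact_mod_cast Nat.factorial_le_pow p
    calc _ ≤ (2 ^ (p + D * p) * (2 ^ p * (p : ℝ) ^ p)) * t ^ p := by gcongr
      _ = _ := by
        have : ((2 : ℝ) ^ (D + 2)) ^ p = 2 ^ (p + D * p) * 2 ^ p := by
          rw [← pow_mul, ← pow_add]; congr 1; ring
        rw [this]; ring

/-- The same bound for a centred Gaussian vector whose covariance operator is at most the
identity. -/
lemma gaussian_sup_le {D : ℕ} (F : ι → MvPolynomial σ ℝ)
    (hF : ∀ i, (F i).IsHomogeneous D) (hσ : 0 < Fintype.card σ) {t : ℝ} (ht : 0 < t)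
    (μ : Measure (EuclideanSpace ℝ ι)) [IsGaussian μ] (hmean : ∀ i, ∫ x, x i ∂μ = 0)
    (hvar : ∀ w : EuclideanSpace ℝ ι, Var[fun x => inner ℝ w x; μ] ≤ ‖w‖ ^ 2) :
    μ {x | ∃ θ : σ → ℝ, t * Fintype.card σ * ∑ i, MvPolynomial.eval θ (F i) ^ 2
          < (∑ i, x i * MvPolynomial.eval θ (F i)) ^ 2}
      ≤ ENNReal.ofReal ((2 ^ (D + 2) / t) ^ Fintype.card σ) := by
  set p := Fintype.card σ
  set e := EuclideanSpace.basisFun ι ℝ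
  set S : Matrix ι ι ℝ := Matrix.of fun i j => covarianceBilin μ (e i) (e j)
  have hSdot : ∀ x y : EuclideanSpace ℝ ι, x.ofLp ⬝ᵥ S *ᵥ y.ofLp = covarianceBilin μ x y := by
    intro x y
    conv_rhs => rw [← e.sum_repr x, ← e.sum_repr y]
    simp [S, e, dotProduct, Matrix.mulVec, Finset.mul_sum, mul_comm, mul_left_comm]
    exact Finset.sum_comm
  have hS : S.PosSemidef := by
    refine Matrix.PosSemidef.of_dotProduct_mulVec_nonneg ?_ fun x => ?_
    · ext i j; simp [S, covarianceBilin_comm]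
    · have := hSdot (WithLp.toLp 2 x) (WithLp.toLp 2 x)
      simp only [star_trivial]
      rw [this]
      exact covarianceBilin_self_nonneg _
  set R := CFC.sqrt S
  have hRR : R * R = S := CFC.sqrt_mul_sqrt_self _ hS.nonneg
  have hRT : Rᵀ = R := by
    have : R.IsHermitian := (CFC.sqrt_nonneg S).isSelfAdjoint
    rwa [Matrix.IsHermitian, Matrix.conjTranspose_eq_transpose_of_trivial] at this
  have hμ : μ = multivariateGaussian 0 S := by
    refine IsGaussian.ext ?_ ?_
    · rw [integral_id_multivariateGaussian']
      ext i
      have := (EuclideanSpace.proj i : EuclideanSpace ℝ ι →L[ℝ] ℝ).integral_comp_id_comm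
        (IsGaussian.integrable_id (μ := μ))
      simpa [hmean i] using this.symm
    · ext x y
      rw [covarianceBilin_multivariateGaussian hS, hSdot]
  have hA : MeasurableSet {x : EuclideanSpace ℝ ι | ∃ θ : σ → ℝ,
      t * p * ∑ i, MvPolynomial.eval θ (F i) ^ 2 < (∑ i, x i * MvPolynomial.eval θ (F i)) ^ 2} := by
    simp_rw [Set.ofPred_exists]
    exact (isOpen_iUnion fun θ => isOpen_lt continuous_const (by fun_prop)).measurableSet
  -- With `x = R g` for `g` standard, `⟨R g, f⟩ = ⟨g, R f⟩`. The map `R F` is again homogeneous of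
  -- degree `D`, and `‖R f‖ ≤ ‖f‖` by `hvar`, so the threshold can only drop.
  set G : ι → MvPolynomial σ ℝ := fun j => ∑ i, MvPolynomial.C (R i j) * F i
  have hG : ∀ j, (G j).IsHomogeneous D := fun j => MvPolynomial.IsHomogeneous.sum _ _ _ fun i _ => by
    simpa using (MvPolynomial.isHomogeneous_C σ (R i j)).mul (hF i)
  refine le_trans ?_ (pi_gaussianReal_sup_le G hG hσ ht)
  rw [hμ, multivariateGaussian, Measure.map_apply (by fun_prop) hA, ← map_pi_eq_stdGaussian,
    Measure.map_apply (by fun_prop) (by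
      exact (Continuous.measurable (by fun_prop)) hA)]
  refine measure_mono ?_
  rintro x ⟨θ, hθ⟩
  refine ⟨θ, ?_⟩
  set f : ι → ℝ := fun i => MvPolynomial.eval θ (F i)
  have hGe : ∀ j, MvPolynomial.eval θ (G j) = (f ᵥ* R) j := by
    intro j; simp [G, f, Matrix.vecMul, dotProduct, mul_comm]
  have h1 : ∑ j, MvPolynomial.eval θ (G j) ^ 2 ≤ ∑ i, f i ^ 2 := by
    calc ∑ j, MvPolynomial.eval θ (G j) ^ 2 = (f ᵥ* R) ⬝ᵥ (R *ᵥ f) := by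
          rw [← hRT, Matrix.mulVec_transpose, hRT]; simp [hGe, dotProduct, sq]
      _ = f ⬝ᵥ S *ᵥ f := by rw [← Matrix.dotProduct_mulVec, Matrix.mulVec_mulVec, hRR]
      _ = covarianceBilin μ (WithLp.toLp 2 f) (WithLp.toLp 2 f) :=
          hSdot (WithLp.toLp 2 f) (WithLp.toLp 2 f)
      _ ≤ ‖WithLp.toLp 2 f‖ ^ 2 := by
          rw [covarianceBilin_self IsGaussian.memLp_two_id]; exact hvar _
      _ = _ := by rw [EuclideanSpace.real_norm_sq_eq]
  have h2 : ∑ j, x j * MvPolynomial.eval θ (G j) = ∑ i, (R *ᵥ x) i * f i := by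
    have := Matrix.dotProduct_mulVec f R x
    simp only [dotProduct] at this
    simp_rw [hGe, mul_comm (x _), ← this, mul_comm]
  rw [h2]
  refine lt_of_le_of_lt (by gcongr) (lt_of_lt_of_eq hθ ?_)
  simp [f, R]

end Polynomial

/-! ### The noise in Euclidean coordinates -/

section Noise

variable {d : ℕ}

/-- The linear map `(a, V) ↦ (a + V m, V R)`; for `R = S^{1/2}` it carries `⟨·,·⟩_{m,S}` to the
Euclidean inner product. -/
def euclMap (m : Fin d → ℝ) (R : Matrix (Fin d) (Fin d) ℝ) :
    Mat d →ₗ[ℝ] (Fin d × Fin (d + 1) → ℝ) where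
  toFun A x := pair (vecPart A + linPart A *ᵥ m) (linPart A * R) x.1 x.2
  map_add' A B := by
    have hl : linPart (A + B) = linPart A + linPart B := rfl
    have hv : vecPart (A + B) = vecPart A + vecPart B := rfl
    ext ⟨r, s⟩
    refine Fin.cases ?_ (fun s => ?_) s
    · simp [pair, hl, hv, Matrix.add_mulVec]; ring
    · simp [pair, hl, Matrix.add_mul]
  map_smul' c A := by
    have hl : linPart (c • A) = c • linPart A := rfl
    have hv : vecPart (c • A) = c • vecPart A := rfl
    ext ⟨r, s⟩
    refine Fin.cases ?_ (fun s => ?_) s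
    · simp [pair, hl, hv, Matrix.smul_mulVec]; ring
    · simp [pair, hl]

@[simp] lemma euclMap_zero (m : Fin d → ℝ) (R : Matrix (Fin d) (Fin d) ℝ) (A : Mat d) (r : Fin d) :
    euclMap m R A (r, 0) = (vecPart A + linPart A *ᵥ m) r := rfl

@[simp] lemma euclMap_succ (m : Fin d → ℝ) (R : Matrix (Fin d) (Fin d) ℝ) (A : Mat d)
    (r s : Fin d) : euclMap m R A (r, s.succ) = (linPart A * R) r s := rfl

lemma innerXi_eq_sum_euclMap {m : Fin d → ℝ} {S R : Matrix (Fin d) (Fin d) ℝ} (hR : R * Rᵀ = S)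
    (A : Mat d) {B : Mat d} (hB : B ∈ Xi d) :
    innerXi m S A B = ∑ x, euclMap m R A x * euclMap m R B x := by
  have hB' : (linPart B)ᵀ = linPart B := hB
  have ht : linPart A * S * linPart B = (linPart A * R) * (linPart B * R)ᵀ := by
    rw [Matrix.transpose_mul, hB', ← hR]; simp only [Matrix.mul_assoc]
  rw [innerXi, ht, Fintype.sum_prod_type]
  simp only [Fin.sum_univ_succ, euclMap_zero, euclMap_succ, Finset.sum_add_distrib]
  rfl

lemma normXi_sq_eq_sum_euclMap {m : Fin d → ℝ} {S R : Matrix (Fin d) (Fin d) ℝ} (hR : R * Rᵀ = S)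
    {A : Mat d} (hA : A ∈ Xi d) : normXi m S A ^ 2 = ∑ x, euclMap m R A x ^ 2 := by
  have h := innerXi_eq_sum_euclMap (m := m) hR A hA
  simp_rw [← sq] at h
  rw [normXi, Real.sq_sqrt (h ▸ Finset.sum_nonneg fun _ _ => sq_nonneg _), h]

/-- `Ξ_d` as a subspace. -/
def xiSubmodule (d : ℕ) : Submodule ℝ (Mat d) where
  carrier := Xi d
  add_mem' {A B} hA hB := by
    change (linPart A + linPart B).IsSymm
    exact Matrix.IsSymm.add hA hB
  zero_mem' := by change (0 : Matrix _ _ ℝ).IsSymm; exact Matrix.isSymm_zero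
  smul_mem' c A hA := by change (c • linPart A).IsSymm; exact Matrix.IsSymm.smul hA c

variable {Ω : Type*} [MeasurableSpace Ω] {P : Measure Ω}
  {m : Fin d → ℝ} {S R : Matrix (Fin d) (Fin d) ℝ}

lemma measurable_euclMap : Measurable (euclMap m R) :=
  (LinearMap.continuous_of_finiteDimensional _).measurable

/-- Gaussianity is given only for pairings with elements of `Ξ_d`. Since the noise stays in the
image of `Ξ_d`, the vector representing any functional may be projected orthogonally onto that
image. -/
lemma IsGaussianNoise.hasGaussianLaw_toLp_euclMap {E : Ω → Mat d}
    (hE : IsGaussianNoise P m S E) (hR : R * Rᵀ = S) :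
    HasGaussianLaw (fun ω => WithLp.toLp 2 (euclMap m R (E ω))) P := by
  have hmeas : Measurable (fun ω => WithLp.toLp 2 (euclMap m R (E ω))) :=
    (by fun_prop : Measurable (WithLp.toLp 2)).comp (measurable_euclMap.comp hE.measurable)
  refine ⟨isGaussian_of_isGaussian_map fun L => ?_⟩
  set U : Submodule ℝ (EuclideanSpace ℝ (Fin d × Fin (d + 1))) :=
    (xiSubmodule d).map ((WithLp.linearEquiv 2 ℝ _).symm.toLinearMap ∘ₗ euclMap m R) with hU
  set w := (InnerProductSpace.toDual ℝ _).symm L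
  obtain ⟨A, hA, hAw⟩ := U.starProjection_apply_mem w
  have hLw : ∀ ω, L (WithLp.toLp 2 (euclMap m R (E ω))) = innerXi m S (E ω) A := by
    intro ω
    have hmem : WithLp.toLp 2 (euclMap m R (E ω)) ∈ U := ⟨E ω, hE.mem ω, rfl⟩
    have h0 := U.starProjection_inner_eq_zero w _ hmem
    rw [inner_sub_left, sub_eq_zero, ← hAw, InnerProductSpace.toDual_symm_apply] at h0
    rw [h0, innerXi_eq_sum_euclMap hR _ hA, PiLp.inner_apply]
    exact Finset.sum_congr rfl fun _ _ => by simp [mul_comm]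
  rw [Measure.map_map (by fun_prop) hmeas]
  have := (hE.gaussian A hA).isGaussian_map
  convert this using 2
  exact funext hLw

lemma IsGaussianNoise.integral_euclMap {E : Ω → Mat d}
    (hE : IsGaussianNoise P m S E) (hR : R * Rᵀ = S) (hdet : IsUnit R.det)
    (x : Fin d × Fin (d + 1)) : ∫ ω, euclMap m R (E ω) x ∂P = 0 := by
  -- A vanishing Bochner integral does not by itself give integrability. It is known for the
  -- Euclidean coordinates, which are Gaussian, and is carried back to the entries of `E` by
  -- inverting `R`.
  have hJ : ∀ x, Integrable (fun ω => euclMap m R (E ω) x) P := fun x =>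
    ((hE.hasGaussianLaw_toLp_euclMap hR).map_fun (EuclideanSpace.proj x)).integrable
  have hlin : ∀ r s, Integrable (fun ω => linPart (E ω) r s) P := by
    intro r s
    have : ∀ ω, linPart (E ω) r s = ∑ k : Fin d, euclMap m R (E ω) (r, k.succ) * R⁻¹ k s := by
      intro ω
      simp only [euclMap_succ]
      rw [← Matrix.mul_apply, Matrix.mul_assoc, Matrix.mul_nonsing_inv _ hdet, Matrix.mul_one]
    simp_rw [this]
    exact integrable_finsetSum _ fun k _ => (hJ _).mul_const _
  have hvec : ∀ r, Integrable (fun ω => vecPart (E ω) r) P := by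
    intro r
    have : ∀ ω, vecPart (E ω) r = euclMap m R (E ω) (r, 0) - ∑ k, linPart (E ω) r k * m k := by
      intro ω; simp [Matrix.mulVec, dotProduct]
    simp_rw [this]
    exact (hJ _).sub (integrable_finsetSum _ fun k _ => (hlin r k).mul_const _)
  have hl0 : ∀ r s, ∫ ω, linPart (E ω) r s ∂P = 0 := fun r s => hE.mean_zero r s.succ
  have hv0 : ∀ r, ∫ ω, vecPart (E ω) r ∂P = 0 := fun r => hE.mean_zero r 0
  obtain ⟨r, s⟩ := x
  refine Fin.cases ?_ (fun s => ?_) s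
  · simp only [euclMap_zero, Pi.add_apply, Matrix.mulVec, dotProduct]
    rw [integral_add (hvec r) (integrable_finsetSum _ fun k _ => (hlin r k).mul_const _), hv0,
      integral_finsetSum _ fun k _ => (hlin r k).mul_const _]
    simp [integral_mul_const, hl0]
  · simp only [euclMap_succ, Matrix.mul_apply]
    rw [integral_finsetSum _ fun k _ => (hlin r k).mul_const _]
    simp [integral_mul_const, hl0]

/-- Cauchy–Schwarz under the expectation: the covariance operator is bounded by its trace, which is
`1`. -/
lemma IsGaussianNoise.variance_inner_le [IsProbabilityMeasure P] {E : Ω → Mat d}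
    (hE : IsGaussianNoise P m S E) (hR : R * Rᵀ = S)
    (w : EuclideanSpace ℝ (Fin d × Fin (d + 1))) :
    Var[fun ω => inner ℝ w (WithLp.toLp 2 (euclMap m R (E ω))); P] ≤ ‖w‖ ^ 2 := by
  have hG := hE.hasGaussianLaw_toLp_euclMap hR
  have hnorm : ∀ ω, ‖WithLp.toLp 2 (euclMap m R (E ω))‖ ^ 2 = normXi m S (E ω) ^ 2 := by
    intro ω
    rw [normXi_sq_eq_sum_euclMap hR (hE.mem ω), EuclideanSpace.real_norm_sq_eq]
  have hint : Integrable (fun ω => normXi m S (E ω) ^ 2) P := by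
    simp_rw [← hnorm]
    exact hG.memLp_two.integrable_norm_pow (by norm_num)
  have hw := hG.map_fun (innerSL ℝ w)
  refine (variance_le_expectation_sq hw.aemeasurable.aestronglyMeasurable).trans ?_
  calc _ ≤ ∫ ω, ‖w‖ ^ 2 * normXi m S (E ω) ^ 2 ∂P := by
        refine integral_mono (hw.memLp_two.integrable_sq) (hint.const_mul _) fun ω => ?_
        simp only [Pi.pow_apply]
        rw [← hnorm, ← mul_pow, ← sq_abs]
        gcongr
        exact abs_real_inner_le_norm w (WithLp.toLp 2 (euclMap m R (E ω)))
    _ = _ := by rw [integral_const_mul, hE.trace_one, mul_one]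

variable {n : ℕ}

/-- The vector of all the errors, in Euclidean coordinates. -/
noncomputable def stackedNoise (m : Fin d → ℝ) (R : Matrix (Fin d) (Fin d) ℝ)
    (E : Fin n → Ω → Mat d) (ω : Ω) : EuclideanSpace ℝ (Fin n × Fin d × Fin (d + 1)) :=
  WithLp.toLp 2 fun x => euclMap m R (E x.1 ω) x.2

variable {E : Fin n → Ω → Mat d}

lemma iIndepFun_toLp_euclMap (hind : iIndepFun E P) :
    iIndepFun (fun i ω => WithLp.toLp 2 (euclMap m R (E i ω))) P :=
  hind.comp (fun _ A => WithLp.toLp 2 (euclMap m R A))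
    fun _ => (by fun_prop : Measurable (WithLp.toLp 2)).comp measurable_euclMap

lemma hasGaussianLaw_stackedNoise (hE : ∀ i, IsGaussianNoise P m S (E i)) (hR : R * Rᵀ = S)
    (hind : iIndepFun E P) : HasGaussianLaw (stackedNoise m R E) P := by
  have h := (iIndepFun_toLp_euclMap (m := m) (R := R) hind).hasGaussianLaw
    fun i => (hE i).hasGaussianLaw_toLp_euclMap hR
  let L : (Fin n → EuclideanSpace ℝ (Fin d × Fin (d + 1))) →ₗ[ℝ]
      EuclideanSpace ℝ (Fin n × Fin d × Fin (d + 1)) :=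
    { toFun := fun y => WithLp.toLp 2 fun x => y x.1 x.2
      map_add' := fun _ _ => rfl
      map_smul' := fun _ _ => rfl }
  exact h.map_fun (LinearMap.toContinuousLinearMap L)

lemma integral_stackedNoise (hE : ∀ i, IsGaussianNoise P m S (E i)) (hR : R * Rᵀ = S)
    (hdet : IsUnit R.det) (x : Fin n × Fin d × Fin (d + 1)) :
    ∫ ω, stackedNoise m R E ω x ∂P = 0 :=
  (hE x.1).integral_euclMap hR hdet x.2

lemma variance_inner_stackedNoise_le [IsProbabilityMeasure P]
    (hE : ∀ i, IsGaussianNoise P m S (E i)) (hR : R * Rᵀ = S)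
    (hind : iIndepFun E P) (w : EuclideanSpace ℝ (Fin n × Fin d × Fin (d + 1))) :
    Var[fun ω => inner ℝ w (stackedNoise m R E ω); P] ≤ ‖w‖ ^ 2 := by
  set v : Fin n → EuclideanSpace ℝ (Fin d × Fin (d + 1)) := fun i => WithLp.toLp 2 fun y => w (i, y)
  have hsum : (fun ω => inner ℝ w (stackedNoise m R E ω))
      = ∑ i, fun ω => inner ℝ (v i) (WithLp.toLp 2 (euclMap m R (E i ω))) := by
    ext ω
    simp [stackedNoise, PiLp.inner_apply, Fintype.sum_prod_type, v]
  have hI := (iIndepFun_toLp_euclMap (m := m) (R := R) hind).comp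
    (fun i y => inner ℝ (v i) y) fun i => by fun_prop
  rw [hsum, IndepFun.variance_sum
    (X := fun i ω => inner ℝ (v i) (WithLp.toLp 2 (euclMap m R (E i ω))))
    (fun i _ => (((hE i).hasGaussianLaw_toLp_euclMap hR).map_fun (innerSL ℝ (v i))).memLp_two)
    fun i _ j _ hij => hI.indepFun hij]
  calc _ ≤ ∑ i, ‖v i‖ ^ 2 := Finset.sum_le_sum fun i _ => (hE i).variance_inner_le hR (v i)
    _ = ‖w‖ ^ 2 := by simp [EuclideanSpace.real_norm_sq_eq, Fintype.sum_prod_type, v]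

end Noise

/-! ### Low-rank tensors as polynomial images of their factors -/

section Tensors

variable {d₁ d₂ : ℕ}

lemma starTensor_apply_zero (A : Tensor d₁ d₂) (p q r) : starTensor A p q r 0 = A p q r 0 := rfl

lemma starTensor_apply_succ (A : Tensor d₁ d₂) (p q r) (s : Fin d₂) :
    starTensor A p q r s.succ = A p q s r.succ := rfl

/-- `𝔸 ↦ (𝔸 + 𝔸^*) / 2` as a linear map. -/
noncomputable def symTensor (d₁ d₂ : ℕ) : Tensor d₁ d₂ →ₗ[ℝ] Tensor d₁ d₂ where
  toFun A := (2⁻¹ : ℝ) • (A + starTensor A)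
  map_add' A B := by
    ext p q r s
    refine Fin.cases ?_ (fun s => ?_) s <;>
      simp [starTensor_apply_zero, starTensor_apply_succ] <;> ring
  map_smul' c A := by
    ext p q r s
    refine Fin.cases ?_ (fun s => ?_) s <;>
      simp [starTensor_apply_zero, starTensor_apply_succ] <;> ring

/-- `Γ_𝔹(X)` as a linear function of `𝔹`. -/
def gamLin (X : Mat d₁) : Tensor d₁ d₂ →ₗ[ℝ] Mat d₂ where
  toFun B := Gam B X
  map_add' A B := by ext r s; simp [Gam, mul_add, Finset.sum_add_distrib]
  map_smul' c A := by ext r s; simp [Gam, Finset.mul_sum, mul_left_comm]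

lemma Gam_symTensor_mem_Xi (A : Tensor d₁ d₂) (X : Mat d₁) : Gam (symTensor d₁ d₂ A) X ∈ Xi d₂ := by
  change (linPart _).IsSymm
  ext r s
  simp [linPart, Gam, symTensor, starTensor_apply_succ, add_comm]

lemma Gam_mem_Xi_of_mem_lowRank {K : ℕ} {B : Tensor d₁ d₂} (hB : B ∈ lowRank d₁ d₂ K)
    (X : Mat d₁) : Gam B X ∈ Xi d₂ := by
  obtain ⟨A, -, rfl⟩ := hB
  exact Gam_symTensor_mem_Xi A X

/-- The coordinates of the factors of a sum of `N` rank-one tensors. -/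
abbrev FactorIdx (d₁ d₂ N : ℕ) : Type :=
  Fin N × ((Fin d₁ ⊕ Fin (d₁ + 1)) ⊕ (Fin d₂ ⊕ Fin (d₂ + 1)))

/-- The sum of rank-one tensors with the given factors. -/
def cpTensor {N : ℕ} (θ : FactorIdx d₁ d₂ N → ℝ) : Tensor d₁ d₂ := fun p q r s =>
  ∑ k, θ (k, .inl (.inl p)) * θ (k, .inl (.inr q)) * θ (k, .inr (.inl r)) * θ (k, .inr (.inr s))

lemma HasRankDecomp.sub {K : ℕ} {A B : Tensor d₁ d₂} (hA : HasRankDecomp K A)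
    (hB : HasRankDecomp K B) : HasRankDecomp (K + K) (A - B) := by
  obtain ⟨a₁, a₂, a₃, a₄, ha⟩ := hA
  obtain ⟨b₁, b₂, b₃, b₄, hb⟩ := hB
  -- The minus sign is absorbed into the first factors.
  refine ⟨Fin.append a₁ (-b₁), Fin.append a₂ b₂, Fin.append a₃ b₃, Fin.append a₄ b₄,
    fun p q r s => ?_⟩
  rw [Fin.sum_univ_add]
  simp only [Fin.append_left, Fin.append_right]
  simp [ha, hb, sub_eq_add_neg]

lemma HasRankDecomp.exists_eq_cpTensor {N : ℕ} {A : Tensor d₁ d₂} (hA : HasRankDecomp N A) :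
    ∃ θ : FactorIdx d₁ d₂ N → ℝ, A = cpTensor θ := by
  obtain ⟨a₁, a₂, a₃, a₄, ha⟩ := hA
  refine ⟨fun x => Sum.elim (Sum.elim (a₁ x.1) (a₂ x.1)) (Sum.elim (a₃ x.1) (a₄ x.1)) x.2, ?_⟩
  ext p q r s
  exact ha p q r s

lemma exists_sub_eq_symTensor_cpTensor {K : ℕ} {B B' : Tensor d₁ d₂} (hB : B ∈ lowRank d₁ d₂ K)
    (hB' : B' ∈ lowRank d₁ d₂ K) :
    ∃ θ : FactorIdx d₁ d₂ (K + K) → ℝ, B - B' = symTensor d₁ d₂ (cpTensor θ) := by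
  obtain ⟨A, hA, rfl⟩ := hB
  obtain ⟨A', hA', rfl⟩ := hB'
  obtain ⟨θ, hθ⟩ := (hA.sub hA').exists_eq_cpTensor
  exact ⟨θ, by rw [← hθ, map_sub]; rfl⟩

/-- Linear functionals of a sum of rank-one tensors are quartic forms in its factors. -/
lemma exists_isHomogeneous_eval_eq {ι : Type*} {N : ℕ} (Λ : Tensor d₁ d₂ →ₗ[ℝ] (ι → ℝ)) :
    ∃ F : ι → MvPolynomial (FactorIdx d₁ d₂ N) ℝ, (∀ i, (F i).IsHomogeneous 4) ∧
      ∀ θ i, MvPolynomial.eval θ (F i) = Λ (cpTensor θ) i := by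
  let e : Fin d₁ → Fin (d₁ + 1) → Fin d₂ → Fin (d₂ + 1) → Tensor d₁ d₂ := fun p q r s =>
    Pi.single p (Pi.single q (Pi.single r (Pi.single s 1)))
  have hdec : ∀ A : Tensor d₁ d₂, A = ∑ p, ∑ q, ∑ r, ∑ s, A p q r s • e p q r s := by
    intro A
    ext p q r s
    simp only [e, Finset.sum_apply, Pi.smul_apply, smul_eq_mul]
    rw [Finset.sum_eq_single p (fun b _ hb => by simp [hb.symm]) (by simp),
      Finset.sum_eq_single q (fun b _ hb => by simp [hb.symm]) (by simp),
      Finset.sum_eq_single r (fun b _ hb => by simp [hb.symm]) (by simp),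
      Finset.sum_eq_single s (fun b _ hb => by simp [hb.symm]) (by simp)]
    simp
  refine ⟨fun i => ∑ p, ∑ q, ∑ r, ∑ s, MvPolynomial.C (Λ (e p q r s) i) *
    ∑ k, MvPolynomial.X (k, .inl (.inl p)) * MvPolynomial.X (k, .inl (.inr q)) *
      MvPolynomial.X (k, .inr (.inl r)) * MvPolynomial.X (k, .inr (.inr s)), fun i => ?_,
    fun θ i => ?_⟩
  · refine .sum _ _ _ fun p _ => .sum _ _ _ fun q _ => .sum _ _ _ fun r _ => .sum _ _ _ fun s _ => ?_
    rw [← Nat.zero_add 4]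
    refine (MvPolynomial.isHomogeneous_C _ _).mul (.sum _ _ _ fun k _ => ?_)
    exact (((MvPolynomial.isHomogeneous_X _ _).mul (MvPolynomial.isHomogeneous_X _ _)).mul
      (MvPolynomial.isHomogeneous_X _ _)).mul (MvPolynomial.isHomogeneous_X _ _)
  · conv_rhs => rw [hdec (cpTensor θ)]
    simp only [map_sum, map_smul, Finset.sum_apply, Pi.smul_apply, smul_eq_mul, map_mul,
      MvPolynomial.eval_C, MvPolynomial.eval_X, cpTensor]
    exact Finset.sum_congr rfl fun p _ => Finset.sum_congr rfl fun q _ =>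
      Finset.sum_congr rfl fun r _ => Finset.sum_congr rfl fun s _ => mul_comm _ _

lemma card_factorIdx (d₁ d₂ N : ℕ) :
    Fintype.card (FactorIdx d₁ d₂ N) = N * (2 * d₁ + 2 * d₂ + 2) := by
  simp; left; ring

end Tensors

/-! ### Affine push-forwards and the Wasserstein bound -/

section Wasserstein

variable {d : ℕ} (ref : Measure (EuclideanSpace ℝ (Fin d))) [IsGaussian ref]

/-- The affine map `x ↦ a + (V + I) x` attached to `(a, V)`. -/
noncomputable def affMap (A : Mat d) (x : EuclideanSpace ℝ (Fin d)) : EuclideanSpace ℝ (Fin d) :=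
  WithLp.toLp 2 (vecPart A) + Matrix.toEuclideanCLM (𝕜 := ℝ) (linPart A + 1) x

lemma affMap_apply (A : Mat d) (x : EuclideanSpace ℝ (Fin d)) (i : Fin d) :
    affMap A x i = vecPart A i + ((linPart A + 1) *ᵥ x.ofLp) i := rfl

lemma continuous_affMap (A : Mat d) : Continuous (affMap A) := by unfold affMap; fun_prop

lemma integral_id_eq_meanVec : ∫ x, x ∂ref = WithLp.toLp 2 (meanVec ref) := by
  ext i
  have := (EuclideanSpace.proj i : EuclideanSpace ℝ (Fin d) →L[ℝ] ℝ).integral_comp_id_comm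
    (IsGaussian.integrable_id (μ := ref))
  simpa [meanVec] using this.symm

lemma covarianceBilin_eq_covMat (x y : EuclideanSpace ℝ (Fin d)) :
    covarianceBilin ref x y = x.ofLp ⬝ᵥ covMat ref *ᵥ y.ofLp := by
  rw [covarianceBilin_apply_eq_cov IsGaussian.memLp_two_id]
  have hm : ∀ i, MemLp (fun u : EuclideanSpace ℝ (Fin d) => u i) 2 ref := fun i =>
    (IsGaussian.hasGaussianLaw_id.map_fun (EuclideanSpace.proj i)).memLp_two
  have hx : ∀ z : EuclideanSpace ℝ (Fin d), (fun u : EuclideanSpace ℝ (Fin d) => inner ℝ z u)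
      = fun u => ∑ i, z i * u i := by
    intro z; ext u; simp [PiLp.inner_apply, mul_comm]
  rw [hx, hx, covariance_fun_sum_fun_sum (fun i => (hm i).const_mul _) fun i => (hm i).const_mul _]
  simp_rw [covariance_const_mul_left, covariance_const_mul_right]
  simp [covMat, dotProduct, Matrix.mulVec, Finset.mul_sum, mul_comm]

/-- `ξ` is the push-forward of the reference measure under the affine map. -/
lemma map_affMap_eq_xi {A : Mat d} (hA : A ∈ Xi d) (hS : (covMat ref).PosSemidef) :
    ref.map (affMap A) = xi ref A := by
  set W := linPart A + 1
  have hW : Wᵀ = W := by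
    have : (linPart A)ᵀ = linPart A := hA
    simp [W, this]
  have hWS : (W * covMat ref * W).PosSemidef := by
    have := hS.mul_mul_conjTranspose_same W
    rwa [Matrix.conjTranspose_eq_transpose_of_trivial, hW] at this
  set L : EuclideanSpace ℝ (Fin d) →L[ℝ] EuclideanSpace ℝ (Fin d) := Matrix.toEuclideanCLM (𝕜 := ℝ) W
  have hcomp : affMap A = (fun x => WithLp.toLp 2 (vecPart A) + x) ∘ L := rfl
  have hmap : ref.map (affMap A) = (ref.map L).map (fun x => WithLp.toLp 2 (vecPart A) + x) := by
    rw [hcomp, Measure.map_map (by fun_prop) (by fun_prop)]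
  have : IsGaussian (ref.map (affMap A)) := by rw [hmap]; infer_instance
  have : IsGaussian (xi ref A) := by unfold xi; infer_instance
  -- Both measures are Gaussian, so means and covariances decide. Symmetry of `W` turns `W Σ Wᵀ`
  -- into the `W Σ W` of `xi`.
  refine IsGaussian.ext ?_ ?_
  · rw [xi, integral_id_multivariateGaussian', integral_map
      (continuous_affMap A).measurable.aemeasurable (by fun_prop)]
    change ∫ x, (WithLp.toLp 2 (vecPart A) + L x) ∂ref = _
    have hL := L.integral_comp_comm (IsGaussian.integrable_id (μ := ref))
    simp only [id, integral_id_eq_meanVec] at hL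
    have hLint : Integrable (fun x => L x) ref := L.integrable_comp IsGaussian.integrable_id
    rw [integral_add (integrable_const _) hLint, integral_const, hL]
    ext i
    simp [L, W, Matrix.add_mulVec]
  · ext x y
    rw [xi, covarianceBilin_multivariateGaussian hWS, hmap, covarianceBilin_map_const_add,
      covarianceBilin_map IsGaussian.memLp_two_id, covarianceBilin_eq_covMat]
    have hadj : L.adjoint = L := by
      rw [← ContinuousLinearMap.star_eq_adjoint, ← map_star, Matrix.star_eq_conjTranspose,
        Matrix.conjTranspose_eq_transpose_of_trivial, hW]
    rw [hadj]
    change (W *ᵥ x.ofLp) ⬝ᵥ covMat ref *ᵥ (W *ᵥ y.ofLp) = _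
    rw [← Matrix.mulVec_mulVec, ← Matrix.mulVec_mulVec, Matrix.dotProduct_mulVec x.ofLp,
      ← Matrix.mulVec_transpose, hW]

/-- The rows of a matrix, as Euclidean vectors. -/
noncomputable def rowVec (V : Matrix (Fin d) (Fin d) ℝ) (i : Fin d) : EuclideanSpace ℝ (Fin d) :=
  WithLp.toLp 2 (V i)

lemma inner_rowVec (V : Matrix (Fin d) (Fin d) ℝ) (i : Fin d) (x : EuclideanSpace ℝ (Fin d)) :
    inner ℝ (rowVec V i) x = (V *ᵥ x.ofLp) i := by
  simp [rowVec, PiLp.inner_apply, Matrix.mulVec, dotProduct, mul_comm]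

/-- The second moment of an affine image of a Gaussian vector. -/
lemma integral_sum_sq_affine (a : Fin d → ℝ) {V : Matrix (Fin d) (Fin d) ℝ} (hV : Vᵀ = V) :
    Integrable (fun x => ∑ i, (a i + inner ℝ (rowVec V i) x) ^ 2) ref ∧
    ∫ x, ∑ i, (a i + inner ℝ (rowVec V i) x) ^ 2 ∂ref
      = (a + V *ᵥ meanVec ref) ⬝ᵥ (a + V *ᵥ meanVec ref) + (V * covMat ref * V).trace := by
  have hI : ∀ i, MemLp (fun x => inner ℝ (rowVec V i) x) 2 ref := fun i =>
    ((IsGaussian.hasGaussianLaw_id (μ := ref)).map_fun (innerSL ℝ (rowVec V i))).memLp_two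
  have hG : ∀ i, MemLp (fun x => a i + inner ℝ (rowVec V i) x) 2 ref := fun i =>
    (memLp_const (a i)).add (hI i)
  refine ⟨integrable_finsetSum _ fun i _ => (hG i).integrable_sq, ?_⟩
  rw [integral_finsetSum _ fun i _ => (hG i).integrable_sq]
  have hmean : ∀ i, ∫ x, (a i + inner ℝ (rowVec V i) x) ∂ref = (a + V *ᵥ meanVec ref) i := by
    intro i
    have := (innerSL ℝ (rowVec V i)).integral_comp_comm
      (IsGaussian.integrable_id (μ := ref))
    simp only [id, innerSL_apply_apply, integral_id_eq_meanVec] at this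
    rw [integral_add (integrable_const _) ((hI i).integrable one_le_two), this]
    simp [inner_rowVec]
  have hvar : ∀ i, Var[fun x => a i + inner ℝ (rowVec V i) x; ref]
      = (V * covMat ref * V) i i := by
    intro i
    rw [variance_const_add (by fun_prop), ← covarianceBilin_self IsGaussian.memLp_two_id,
      covarianceBilin_eq_covMat, Matrix.dotProduct_mulVec, Matrix.mul_apply]
    have hs : ∀ j, V j i = V i j := fun j => congrFun (congrFun hV i) j
    simp only [rowVec, dotProduct, Matrix.vecMul, Matrix.mul_apply, hs]
  have hsq : ∀ i, ∫ x, (a i + inner ℝ (rowVec V i) x) ^ 2 ∂ref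
      = (a + V *ᵥ meanVec ref) i * (a + V *ᵥ meanVec ref) i + (V * covMat ref * V) i i := by
    intro i
    have := variance_eq_sub (hG i)
    rw [hvar, hmean] at this
    simp only [Pi.pow_apply] at this
    linarith
  simp_rw [hsq, Finset.sum_add_distrib]
  rfl

lemma norm_affMap_sub_sq (A B : Mat d) (x : EuclideanSpace ℝ (Fin d)) :
    ‖affMap A x - affMap B x‖ ^ 2
      = ∑ i, (vecPart (A - B) i + inner ℝ (rowVec (linPart (A - B)) i) x) ^ 2 := by
  rw [EuclideanSpace.real_norm_sq_eq]
  refine Finset.sum_congr rfl fun i _ => ?_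
  have hl : linPart (A - B) = linPart A - linPart B := rfl
  have hv : vecPart (A - B) = vecPart A - vecPart B := rfl
  congr 1
  rw [PiLp.sub_apply, affMap_apply, affMap_apply, hl, hv]
  rw [inner_rowVec, Matrix.add_mulVec, Matrix.add_mulVec, Matrix.sub_mulVec]
  simp only [Pi.add_apply, Pi.sub_apply]
  ring

lemma integral_norm_affMap_sub_sq {A B : Mat d} (hA : A ∈ Xi d) (hB : B ∈ Xi d) :
    Integrable (fun x => ‖affMap A x - affMap B x‖ ^ 2) ref ∧
    ∫ x, ‖affMap A x - affMap B x‖ ^ 2 ∂ref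
      = innerXi (meanVec ref) (covMat ref) (A - B) (A - B) := by
  simp_rw [norm_affMap_sub_sq]
  exact integral_sum_sq_affine ref _ ((xiSubmodule d).sub_mem hA hB)

/-- `ξ` is 1-Lipschitz from `Ξ_d` to the Wasserstein space. -/
lemma wassersteinDist_xi_le {A B : Mat d} (hA : A ∈ Xi d) (hB : B ∈ Xi d)
    (hS : (covMat ref).PosSemidef) :
    wassersteinDist (xi ref A) (xi ref B) ≤ normXi (meanVec ref) (covMat ref) (A - B) := by
  obtain ⟨hint, hval⟩ := integral_norm_affMap_sub_sq ref hA hB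
  have hmA := (continuous_affMap A).measurable
  have hmB := (continuous_affMap B).measurable
  -- One reference point drives both affine maps. An upper bound needs only some coupling, so
  -- optimality plays no role.
  have hπ : ref.map (fun x => (affMap A x, affMap B x)) ∈ couplings (xi ref A) (xi ref B) := by
    constructor
    · rw [Measure.map_map (by fun_prop) (by fun_prop), ← map_affMap_eq_xi ref hA hS]; rfl
    · rw [Measure.map_map (by fun_prop) (by fun_prop), ← map_affMap_eq_xi ref hB hS]; rfl
  have hcost : ∫⁻ p, ‖p.1 - p.2‖ₑ ^ 2 ∂(ref.map (fun x => (affMap A x, affMap B x)))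
      = ENNReal.ofReal (innerXi (meanVec ref) (covMat ref) (A - B) (A - B)) := by
    rw [lintegral_map (by fun_prop) (by fun_prop), ← hval,
      ofReal_integral_eq_lintegral_ofReal hint (Filter.Eventually.of_forall fun x => by positivity)]
    refine lintegral_congr fun x => ?_
    rw [ENNReal.ofReal_pow (norm_nonneg _), ofReal_norm]
  have h0 : 0 ≤ innerXi (meanVec ref) (covMat ref) (A - B) (A - B) :=
    hval ▸ integral_nonneg fun x => by positivity
  rw [wassersteinDist, normXi]
  refine Real.sqrt_le_sqrt (ENNReal.toReal_le_of_le_ofReal h0 ?_)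
  rw [← hcost]
  exact iInf₂_le _ hπ

end Wasserstein

/-! ### Basic inequality and uniform control of the noise -/

section Regression

lemma exists_mul_transpose_eq_of_posDef {d : ℕ} {S : Matrix (Fin d) (Fin d) ℝ} (hS : S.PosDef) :
    ∃ R : Matrix (Fin d) (Fin d) ℝ, R * Rᵀ = S ∧ IsUnit R.det := by
  have hR : CFC.sqrt S * CFC.sqrt S = S := CFC.sqrt_mul_sqrt_self _ hS.posSemidef.nonneg
  have hT : (CFC.sqrt S)ᵀ = CFC.sqrt S := by
    have : (CFC.sqrt S).IsHermitian := (CFC.sqrt_nonneg S).isSelfAdjoint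
    rwa [Matrix.IsHermitian, Matrix.conjTranspose_eq_transpose_of_trivial] at this
  refine ⟨CFC.sqrt S, by rw [hT, hR], isUnit_iff_ne_zero.2 fun h0 => hS.det_pos.ne' ?_⟩
  rw [← hR, Matrix.det_mul, h0, mul_zero]

variable {d₁ d₂ K n : ℕ}

/-- The least squares estimator satisfies the basic inequality `‖δ‖² ≤ 2 ⟨E, δ⟩`, in Euclidean
coordinates. -/
lemma IsLeastSquares.basic_inequality {𝓑 : Set (Tensor d₁ d₂)} {m : Fin d₂ → ℝ}
    {S R : Matrix (Fin d₂) (Fin d₂) ℝ} (hR : R * Rᵀ = S) {X : Fin n → Mat d₁}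
    {E : Fin n → Mat d₂} {B₀ B : Tensor d₁ d₂} (hB₀ : B₀ ∈ 𝓑) (hE : ∀ i, E i ∈ Xi d₂)
    (hδ : ∀ i, Gam (B - B₀) (X i) ∈ Xi d₂)
    (h : IsLeastSquares 𝓑 m S X (fun i => Gam B₀ (X i) + E i) B) :
    ∑ i, ∑ y, euclMap m R (Gam (B - B₀) (X i)) y ^ 2
      ≤ 2 * ∑ i, ∑ y, euclMap m R (E i) y * euclMap m R (Gam (B - B₀) (X i)) y := by
  have hmin := h.2 hB₀
  simp only [Set.mem_ofPred_eq] at hmin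
  have h1 : ∀ i, Gam B₀ (X i) + E i - Gam B (X i) = E i - Gam (B - B₀) (X i) := by
    intro i
    have : Gam (B - B₀) (X i) = Gam B (X i) - Gam B₀ (X i) := map_sub (gamLin (X i)) B B₀
    rw [this]; abel
  simp_rw [h1, add_sub_cancel_left] at hmin
  have h2 : ∀ i, normXi m S (E i - Gam (B - B₀) (X i)) ^ 2 = normXi m S (E i) ^ 2
      + ∑ y, euclMap m R (Gam (B - B₀) (X i)) y ^ 2
      - 2 * ∑ y, euclMap m R (E i) y * euclMap m R (Gam (B - B₀) (X i)) y := by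
    intro i
    rw [normXi_sq_eq_sum_euclMap hR ((xiSubmodule d₂).sub_mem (hE i) (hδ i)),
      normXi_sq_eq_sum_euclMap hR (hE i), Finset.mul_sum, ← Finset.sum_add_distrib,
      ← Finset.sum_sub_distrib]
    refine Finset.sum_congr rfl fun y _ => ?_
    rw [map_sub, Pi.sub_apply]; ring
  simp_rw [h2, Finset.sum_sub_distrib, Finset.sum_add_distrib, ← Finset.mul_sum] at hmin
  linarith

lemma predError_le {ref₁ : Measure (EuclideanSpace ℝ (Fin d₁))}
    {ref₂ : Measure (EuclideanSpace ℝ (Fin d₂))} [IsGaussian ref₂]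
    {R : Matrix (Fin d₂) (Fin d₂) ℝ} (hR : R * Rᵀ = covMat ref₂)
    (hS : (covMat ref₂).PosSemidef) (ν₁ : Fin n → Measure (EuclideanSpace ℝ (Fin d₁)))
    {B B₀ : Tensor d₁ d₂} (hB : B ∈ lowRank d₁ d₂ K) (hB₀ : B₀ ∈ lowRank d₁ d₂ K) :
    predError ref₁ ref₂ ν₁ B B₀ ≤ √((1 / (n : ℝ)) * ∑ i, ∑ y,
      euclMap (meanVec ref₂) R (Gam (B - B₀) (phi ref₁ (ν₁ i))) y ^ 2) := by
  refine Real.sqrt_le_sqrt (mul_le_mul_of_nonneg_left (Finset.sum_le_sum fun i _ => ?_)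
    (by positivity))
  have hX := Gam_mem_Xi_of_mem_lowRank hB (phi ref₁ (ν₁ i))
  have hX₀ := Gam_mem_Xi_of_mem_lowRank hB₀ (phi ref₁ (ν₁ i))
  have hsub : Gam (B - B₀) (phi ref₁ (ν₁ i)) = Gam B (phi ref₁ (ν₁ i)) - Gam B₀ (phi ref₁ (ν₁ i)) :=
    map_sub (gamLin (phi ref₁ (ν₁ i))) B B₀
  rw [hsub, ← normXi_sq_eq_sum_euclMap hR ((xiSubmodule d₂).sub_mem hX hX₀)]
  exact pow_le_pow_left₀ (Real.sqrt_nonneg _) (wassersteinDist_xi_le ref₂ hX hX₀ hS) 2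

/-- The noise is unlikely to correlate strongly with a difference of two low-rank signals. -/
lemma stackedNoise_sup_le {Ω : Type*} [MeasurableSpace Ω] {P : Measure Ω} [IsProbabilityMeasure P]
    {m : Fin d₂ → ℝ} {S R : Matrix (Fin d₂) (Fin d₂) ℝ} (hR : R * Rᵀ = S) (hdet : IsUnit R.det)
    {E : Fin n → Ω → Mat d₂} (hE : ∀ i, IsGaussianNoise P m S (E i)) (hind : iIndepFun E P)
    (X : Fin n → Mat d₁) {N : ℕ} (hN : 0 < N) {t : ℝ} (ht : 0 < t) :
    P {ω | ∃ θ : FactorIdx d₁ d₂ N → ℝ, t * (N * (2 * d₁ + 2 * d₂ + 2) : ℕ) *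
        ∑ i, ∑ y, euclMap m R (Gam (symTensor d₁ d₂ (cpTensor θ)) (X i)) y ^ 2
      < (∑ i, ∑ y, euclMap m R (E i ω) y *
          euclMap m R (Gam (symTensor d₁ d₂ (cpTensor θ)) (X i)) y) ^ 2}
      ≤ ENNReal.ofReal ((64 / t) ^ (N * (2 * d₁ + 2 * d₂ + 2))) := by
  have hlaw := hasGaussianLaw_stackedNoise hE hR hind
  have := hlaw.isGaussian_map
  let Λ : Tensor d₁ d₂ →ₗ[ℝ] (Fin n × Fin d₂ × Fin (d₂ + 1) → ℝ) :=
    LinearMap.pi fun x => LinearMap.proj x.2 ∘ₗ euclMap m R ∘ₗ gamLin (X x.1) ∘ₗ symTensor d₁ d₂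
  obtain ⟨F, hF, hFe⟩ := exists_isHomogeneous_eval_eq (N := N) Λ
  have hσ : 0 < Fintype.card (FactorIdx d₁ d₂ N) := by rw [card_factorIdx]; positivity
  have hsup := gaussian_sup_le F hF hσ ht (P.map (stackedNoise m R E))
    (fun i => by
      rw [integral_map hlaw.aemeasurable (by fun_prop)]
      exact integral_stackedNoise hE hR hdet i)
    (fun w => by
      rw [variance_map (by fun_prop) hlaw.aemeasurable]
      exact variance_inner_stackedNoise_le hE hR hind w)
  rw [card_factorIdx] at hsup
  -- The constant is `64 = 2 ^ (4 + 2)`, from degree `D = 4`.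
  refine le_trans ?_ (hsup.trans (le_of_eq (by norm_num)))
  refine le_trans (measure_mono ?_) (Measure.le_map_apply hlaw.aemeasurable _)
  rintro ω ⟨θ, hθ⟩
  refine ⟨θ, ?_⟩
  simp_rw [hFe, Fintype.sum_prod_type (α₁ := Fin n)]
  exact hθ

end Regression

end GaussReg

/-! ### Conclusion -/

open GaussReg in
theorem theorem2 (ε : ℝ) (hε : 0 < ε) :
    ∃ M : ℝ, 0 < M ∧
      ∀ (d₁ d₂ K : ℕ), 1 ≤ d₁ → 1 ≤ d₂ → 1 ≤ K → K ≤ min d₁ d₂ →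
      -- the non-singular Gaussian reference measures
      ∀ (ref₁ : Measure (EuclideanSpace ℝ (Fin d₁)))
        (ref₂ : Measure (EuclideanSpace ℝ (Fin d₂))),
        ref₁ ∈ gaussianSpace d₁ → (covMat ref₁).PosDef →
        ref₂ ∈ gaussianSpace d₂ → (covMat ref₂).PosDef →
      -- the sample size and the fixed Gaussian predictors
      ∀ (n : ℕ), 1 ≤ n →
      ∀ (ν₁ : Fin n → Measure (EuclideanSpace ℝ (Fin d₁))), (∀ i, ν₁ i ∈ gaussianSpace d₁) →
      -- the true coefficient tensor
      ∀ B₀ ∈ lowRank d₁ d₂ K,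
        (∀ i, Gam B₀ (phi ref₁ (ν₁ i)) ∈ phi ref₂ '' gaussianSpace d₂) →
      -- independent Gaussian errors and the responses
      ∀ (Ω : Type u) [MeasurableSpace Ω] (P : Measure Ω) [IsProbabilityMeasure P]
        (E Y : Fin n → Ω → Mat d₂),
        (∀ i, IsGaussianNoise P (meanVec ref₂) (covMat ref₂) (E i)) →
        iIndepFun E P →
        (∀ i ω, Y i ω = Gam B₀ (phi ref₁ (ν₁ i)) + E i ω) →
      -- the estimator
      ∀ Bt : Ω → Tensor d₁ d₂,
        P {ω | IsLeastSquares (lowRank d₁ d₂ K) (meanVec ref₂) (covMat ref₂)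
                  (fun i => phi ref₁ (ν₁ i)) (fun i => Y i ω) (Bt ω) ∧
                (∀ i, Gam (Bt ω) (phi ref₁ (ν₁ i)) ∈ phi ref₂ '' gaussianSpace d₂) ∧
                M * (√((K : ℝ) * ((d₁ : ℝ) + (d₂ : ℝ))) / √(n : ℝ)) <
                  predError ref₁ ref₂ ν₁ (Bt ω) B₀}
          ≤ ENNReal.ofReal ε := by
  -- Truncation at `1` ensures `ε' ^ p ≤ ε'`; the choice of `t` makes the tail `(64 / t) ^ p` equal
  -- to `ε' ^ p`.
  set ε' := min ε 1
  have hε' : 0 < ε' := lt_min hε one_pos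
  set t := 64 / ε' with ht_def
  have ht : 0 < t := by positivity
  refine ⟨2 * √(6 * t), by positivity, ?_⟩
  intro d₁ d₂ K hd₁ hd₂ hK _ ref₁ ref₂ _ _ href₂ hS n hn ν₁ _ B₀ hB₀ _ Ω _ P _ E Y hE hind hY Bt
  have : IsGaussian ref₂ := href₂
  obtain ⟨R, hR, hdet⟩ := exists_mul_transpose_eq_of_posDef hS
  have hsup := stackedNoise_sup_le hR hdet hE hind (fun i => phi ref₁ (ν₁ i))
    (N := K + K) (by omega) ht
  set p := (K + K) * (2 * d₁ + 2 * d₂ + 2)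
  have hp : p ≠ 0 := by positivity
  -- Here `p = 4K(d₁ + d₂ + 1)`, and `d₁ + d₂ ≥ 2` absorbs the extra `1`.
  have hp_le : (p : ℝ) ≤ 6 * (K * (d₁ + d₂)) := by
    have : p ≤ 6 * (K * (d₁ + d₂)) := by simp only [p]; nlinarith
    exact_mod_cast this
  refine (measure_mono ?_).trans (hsup.trans (ENNReal.ofReal_le_ofReal ?_))
  · rintro ω ⟨hls, -, hlt⟩
    obtain ⟨θ, hθ⟩ := exists_sub_eq_symTensor_cpTensor hls.1 hB₀
    refine ⟨θ, ?_⟩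
    simp only [hY] at hls
    have hbasic := hls.basic_inequality hR hB₀ (fun i => (hE i).mem ω)
      fun i => by rw [hθ]; exact Gam_symTensor_mem_Xi _ _
    have hpred := hlt.trans_le (predError_le (ref₁ := ref₁) hR hS.posSemidef ν₁ hls.1 hB₀)
    rw [hθ] at hbasic hpred
    set U := ∑ i, ∑ y, euclMap (meanVec ref₂) R
      (Gam (symTensor d₁ d₂ (cpTensor θ)) (phi ref₁ (ν₁ i))) y ^ 2
    have hn0 : (0 : ℝ) < n := by exact_mod_cast hn
    -- Squaring the constant gives `M² = 4 * 6 * t`, and the factors `1 / n` on both sides cancel.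
    have hU : 4 * t * p < U := by
      rw [Real.lt_sqrt (by positivity), mul_pow, div_pow, mul_pow, Real.sq_sqrt (by positivity),
        Real.sq_sqrt (by positivity), Real.sq_sqrt hn0.le, one_div, ← div_eq_inv_mul,
        ← mul_div_assoc, div_lt_div_iff_of_pos_right hn0] at hpred
      nlinarith
    have hpos : 0 ≤ t * p := by positivity
    -- From `U > 4tp` and `U ≤ 2⟨E, δ⟩` it follows that `t p U < U² / 4 ≤ ⟨E, δ⟩²`.
    nlinarith
  · have h64 : 64 / t = ε' := by rw [ht_def]; field_simp
    rw [h64]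
    exact (pow_le_of_le_one hε'.le (min_le_right _ _) hp).trans (min_le_left _ _)
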